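/- Let $k$ be a field. An $\mathbb{N}$-graded $k$-algebra $A=\bigoplus_{n\ge 0}A_n$ with $A_0=k$ is called quadratic if $A=T_k(V)/\langle R\rangle$, with the usual grading, for a finite-dimensional vector space $V$ and a subspace $R\subseteq V\otimes V$. A quadratic algebra $A$ is called Koszul if the trivial left module ${}_Ak=A/A_{\ge 1}$ has a resolution $\cdots\to P_1\to P_0\to {}_Ak\to 0$ by graded projective left $A$-modules and degree-preserving maps such that $P_n$ is generated in degree $n$ for all $n\ge 0$. Let $A$ be a subalgebra of a $k$-algebra $B$, let $y_1,y_2\in B$ and $p,q\in k$, and let $\sigma=(\sigma_{ij}):A\to M_{2\times 2}(A)$ be a map. We say that $B=A_P[y_1,y_2;\sigma]$, $P=\{p,q\}$, is a trimmed right double Ore extension of $A$ if $B$ is generated by $A$, $y_1$ and $y_2$; $y_2y_1=p\,y_1y_2+q\,y_1^2$; $B$ is a free left $A$-module with basis $\{y_1^iy_2^j : i,j\ge 0\}$; and $y_ia=\sigma_{i1}(a)y_1+\sigma_{i2}(a)y_2$ for all $a\in A$ and $i=1,2$. Proposition. Let $A$ be a Koszul algebra and let $B=A_P[y_1,y_2;\sigma]$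 be a trimmed right double Ore extension of $A$ such that every $\sigma_{ij}$ preserves degrees, i.e. $\sigma_{ij}(A_n)\subseteq A_n$ for all $n$. Then $B$ is a Koszul algebra for the grading that extends the grading of $A$ and in which $y_1$ and $y_2$ have degree $1$, i.e. $B_n=\sum_{m+i+j=n}A_m\,y_1^iy_2^j$. -/

import Mathlib

universe u

/-- The family `𝒜` of subspaces is an `ℕ`-grading of the `k`-algebra `A`. -/
def IsGradedAlgebra {k A : Type*} [Field k] [Ring A] [Algebra k A]
    (𝒜 : ℕ → Submodule k A) : Prop :=
  Nonempty (GradedAlgebra 𝒜)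

/-- The canonical algebra homomorphism `T_k(A₁) → A`. -/
noncomputable def tensorToAlgebra {k A : Type*} [Field k] [Ring A] [Algebra k A]
    (𝒜 : ℕ → Submodule k A) : TensorAlgebra k (𝒜 1) →ₐ[k] A :=
  TensorAlgebra.lift k (𝒜 1).subtype

/-- `A`, graded by `𝒜`, is a quadratic algebra: it is a connected graded algebra, and it is
`T_k(V) / ⟨R⟩` with its usual grading, where `V = A₁` is finite-dimensional and
`R` is a subspace of `V ⊗ V`. -/
structure IsQuadraticAlgebra {k A : Type*} [Field k] [Ring A] [Algebra k A]
    (𝒜 : ℕ → Submodule k A) : Prop where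
  graded : IsGradedAlgebra 𝒜
  nontrivial : Nontrivial A
  degree_zero : 𝒜 0 = LinearMap.range (Algebra.linearMap k A)
  finite_degree_one : FiniteDimensional k (𝒜 1)
  generated : Function.Surjective (tensorToAlgebra 𝒜)
  relations : ∃ R : Submodule k (TensorAlgebra k (𝒜 1)),
    R ≤ LinearMap.range (TensorAlgebra.ι k (M := 𝒜 1)) ^ 2 ∧
    ∀ t, tensorToAlgebra 𝒜 t = 0 ↔
      t ∈ TwoSidedIdeal.span (R : Set (TensorAlgebra k (𝒜 1)))

/-- The left ideal `A_{≥ 1}`. -/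
def augmentationIdeal {k A : Type*} [Field k] [Ring A] [Algebra k A]
    (𝒜 : ℕ → Submodule k A) : Submodule A A :=
  Submodule.span A {a | ∃ n, 1 ≤ n ∧ a ∈ 𝒜 n}

/-- The trivial left module `k = A / A_{≥ 1}`, which lives in degree `0`. -/
abbrev TrivialModule {k A : Type*} [Field k] [Ring A] [Algebra k A]
    (𝒜 : ℕ → Submodule k A) : Type _ :=
  A ⧸ augmentationIdeal 𝒜

/-- A resolution `⋯ → P₁ → P₀ → k → 0` of the trivial left `A`-module by graded projective left
modules and degree-preserving maps, in which `P n` is generated in degree `n`.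
Here `deg n m` is the component of degree `m` of `P n`. -/
structure LinearProjectiveResolution {k : Type*} {A : Type u} [Field k] [Ring A] [Algebra k A]
    (𝒜 : ℕ → Submodule k A) where
  P : ℕ → Type u
  [addCommGroup : ∀ n, AddCommGroup (P n)]
  [module : ∀ n, Module A (P n)]
  projective : ∀ n, Module.Projective A (P n)
  deg : ∀ n, ℕ → AddSubgroup (P n)
  isInternal : ∀ n, DirectSum.IsInternal (deg n)
  smul_mem : ∀ n i j (a : A) (x : P n), a ∈ 𝒜 i → x ∈ deg n j → a • x ∈ deg n (i + j)
  generated : ∀ n, Submodule.span A (deg n n : Set (P n)) = ⊤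
  d : ∀ n, P (n + 1) →ₗ[A] P n
  d_mem : ∀ n m x, x ∈ deg (n + 1) m → d n x ∈ deg n m
  ε : P 0 →ₗ[A] TrivialModule 𝒜
  ε_eq_zero : ∀ m x, 1 ≤ m → x ∈ deg 0 m → ε x = 0
  exact_d : ∀ n, Function.Exact (d (n + 1)) (d n)
  exact_ε : Function.Exact (d 0) ε
  surjective_ε : Function.Surjective ε

/-- `A`, graded by `𝒜`, is a Koszul algebra. -/
def IsKoszulAlgebra {k A : Type*} [Field k] [Ring A] [Algebra k A]
    (𝒜 : ℕ → Submodule k A) : Prop :=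
  IsQuadraticAlgebra 𝒜 ∧ Nonempty (LinearProjectiveResolution 𝒜)

/-- `B = A_P[y₁, y₂; σ, δ, τ]` is a right double Ore extension of its subalgebra `A`, where
`P = {p, q}` and `τ = {τ₀, τ₁, τ₂}`. -/
structure IsRightDoubleOreExtension {k B : Type*} [Field k] [Ring B] [Algebra k B]
    (A : Subalgebra k B) (p q : k) (y₁ y₂ : B) (σ : A → Matrix (Fin 2) (Fin 2) A)
    (δ : A → Fin 2 → A) (τ₀ τ₁ τ₂ : A) : Prop where
  generated : Algebra.adjoin k ((A : Set B) ∪ {y₁, y₂}) = ⊤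
  relation : y₂ * y₁ = p • (y₁ * y₂) + q • y₁ ^ 2 + τ₁ * y₁ + τ₂ * y₂ + τ₀
  linearIndependent : LinearIndependent A (fun ij : ℕ × ℕ => y₁ ^ ij.1 * y₂ ^ ij.2)
  span_eq_top : Submodule.span A (Set.range fun ij : ℕ × ℕ => y₁ ^ ij.1 * y₂ ^ ij.2) = ⊤
  y₁_mul : ∀ a : A, y₁ * a = σ a 0 0 * y₁ + σ a 0 1 * y₂ + δ a 0
  y₂_mul : ∀ a : A, y₂ * a = σ a 1 0 * y₁ + σ a 1 1 * y₂ + δ a 1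

/-- `B = A_P[y₁, y₂; σ]` is a trimmed right double Ore extension of `A`: `δ = 0` and `τ = {0}`. -/
def IsTrimmedRightDoubleOreExtension {k B : Type*} [Field k] [Ring B] [Algebra k B]
    (A : Subalgebra k B) (p q : k) (y₁ y₂ : B) (σ : A → Matrix (Fin 2) (Fin 2) A) : Prop :=
  IsRightDoubleOreExtension A p q y₁ y₂ σ 0 0 0 0

/-- The grading of `B = A_P[y₁, y₂; σ]` that extends the grading `𝒜` of `A` and in which `y₁` and
`y₂` have degree `1`: the component of degree `n` is the sum of all `A_m y₁^i y₂^j` with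
`m + i + j = n`. -/
def doubleOreGrading {k B : Type*} [Field k] [Ring B] [Algebra k B]
    (A : Subalgebra k B) (𝒜 : ℕ → Submodule k A) (y₁ y₂ : B) : ℕ → Submodule k B :=
  fun n => Submodule.span k
    {b | ∃ m i j, m + i + j = n ∧ ∃ a ∈ 𝒜 m, b = (a : B) * (y₁ ^ i * y₂ ^ j)}

/-! The algebra `B` retracts onto `A`: the coefficient of `1` in the basis `y₁^i y₂^j` is a ring
homomorphism `B → A` that kills `y₁` and `y₂` (`retraction`). Along it `A` becomes a graded left
`B`-module with a linear free resolution `0 → B(-2) → B(-1)² → B → A → 0`, whose maps are `(u, v) ↦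
u y₁ + v y₂` and `r ↦ (r (y₂ - q y₁), -p r y₁)`. The composite vanishes because `(y₂ - q y₁) y₁ = p
y₁ y₂`. Exactness rests on division by `y₂`: `divY₂ (r (y₂ - q y₁)) = r - N r` with `N` locally
nilpotent (`nilOp`), so `1 - N` is invertible, whether or not `p` is zero (`exists_of_add_eq_zero`,
`hasLinearCover_kerGMod_freeRes`).

The trivial `B`-module is the restriction of the trivial `A`-module, so the linear resolution over
`A` and the one of `A` over `B` have to be combined. No total complex is built. Instead, a family `𝒞
n` of graded modules is sought in which each member has a free cover generated in degree `n` with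
kernel in `𝒞 (n + 1)` (`HasLinearCover`). If the trivial module lies in `𝒞 0`, splicing covers gives
the resolution (`nonempty_resolution`). The family for `B` is the closure under extensions of the
restricted syzygies of `A`, the kernels of `B^ι → A^ι`, and the free modules (`ExtClosure`).
Extensions are treated by the horseshoe lemma (`hasLinearCover_of_isExtension`), restrictions by
`hasLinearCover_resGMod`. The given resolution over `A` is only projective; since `A` is connected,
its terms are graded free (`exists_free_of_projective`).

That `B` is quadratic is a straightening argument: modulo the quadratic relations every tensor is a
sum of terms `t y₁^i y₂^j` with `t` a tensor over `A₁`. If its image in `B` is zero, freeness of `B`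
over `A` makes each coefficient zero in `A`, hence a consequence of the relations of `A`
(`mem_span_quadraticRelations`). -/

section

open DirectSum

/-! ### Internal gradings and homogeneous preimages. -/

section Internal

variable {M N S S' : Type*} [AddCommGroup M] [AddCommGroup N] [SetLike S M] [AddSubmonoidClass S M]
  [SetLike S' N] [AddSubmonoidClass S' N]

theorem isInternal_of_projections (ℳ : ℕ → S) (ψ : ℕ → M →+ M)
    (hψ : ∀ m l, ∀ x ∈ ℳ l, ψ m x = if l = m then x else 0)
    (hs : AddSubmonoid.closure (⋃ m, (ℳ m : Set M)) = ⊤) : DirectSum.IsInternal ℳ := by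
  constructor
  · have key : ∀ x m, ψ m (DirectSum.coeAddMonoidHom ℳ x) = x m := by
      intro x m
      induction x using DirectSum.induction_on with
      | zero => simp
      | of l y =>
        rw [DirectSum.coeAddMonoidHom_of, hψ m l y y.2]
        split_ifs with h
        · subst h; simp
        · rw [DirectSum.of_eq_of_ne _ _ _ (Ne.symm h)]; simp
      | add x y hx hy => simp [hx, hy]
    intro x y hxy
    ext m
    rw [← key x m, ← key y m, hxy]
  · rw [← AddMonoidHom.mrange_eq_top, eq_top_iff, ← hs, AddSubmonoid.closure_le]
    intro x hx
    obtain ⟨m, hm⟩ := Set.mem_iUnion.1 hx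
    exact ⟨DirectSum.of _ m ⟨x, hm⟩, by simp⟩

theorem decompose_map (ℳ : ℕ → S) (𝒩 : ℕ → S') [Decomposition ℳ] [Decomposition 𝒩]
    (f : M →+ N) (hf : ∀ m, ∀ x ∈ ℳ m, f x ∈ 𝒩 m) (x : M) (m : ℕ) :
    (decompose 𝒩 (f x) m : N) = f (decompose ℳ x m) := by
  induction x using DirectSum.Decomposition.inductionOn ℳ with
  | zero => simp
  | @homogeneous i y =>
    by_cases h : i = m
    · subst h
      rw [decompose_of_mem_same _ (hf _ _ y.2), decompose_of_mem_same _ y.2]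
    · rw [decompose_of_mem_ne _ (hf _ _ y.2) h, decompose_of_mem_ne _ y.2 h, map_zero]
  | add x y hx hy => simp [hx, hy]

/-- A degree-preserving map commutes with taking components, so the degree `m` component of `x` has
the same image as `x`. -/
theorem exists_homogeneous_preimage {ℳ : ℕ → S} {𝒩 : ℕ → S'} (hM : IsInternal ℳ)
    (hN : IsInternal 𝒩) (f : M →+ N) (hf : ∀ m, ∀ x ∈ ℳ m, f x ∈ 𝒩 m) {x : M} {m : ℕ}
    (hx : f x ∈ 𝒩 m) : ∃ y ∈ ℳ m, f y = f x := by
  let := hM.chooseDecomposition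
  let := hN.chooseDecomposition
  refine ⟨decompose ℳ x m, SetLike.coe_mem _, ?_⟩
  rw [← decompose_map ℳ 𝒩 f hf, decompose_of_mem_same _ hx]

theorem isInternal_concentrated (M : Type*) [AddCommGroup M] :
    IsInternal fun m : ℕ => if m = 0 then (⊤ : AddSubgroup M) else ⊥ := by
  refine isInternal_of_projections _ (fun m => if m = 0 then AddMonoidHom.id M else 0) ?_ ?_
  · intro m l x hx
    by_cases hl : l = 0 <;> by_cases hm : m = 0 <;> simp_all [eq_comm]
  · rw [eq_top_iff]
    intro x _
    exact AddSubmonoid.subset_closure (Set.mem_iUnion.2 ⟨0, by simp⟩)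

end Internal

/-! ### Graded free modules and shifts. -/

section Free

variable {k A : Type*} [Field k] [Ring A] [Algebra k A]

/-- The component of degree `m` of `A(-s)`. -/
def shiftDeg (𝒜 : ℕ → Submodule k A) (s m : ℕ) : Submodule k A :=
  if s ≤ m then 𝒜 (m - s) else ⊥

/-- The component of degree `m` of the graded free module whose basis elements `i` have
degrees `s i`. -/
def freeDeg (𝒜 : ℕ → Submodule k A) {ι : Type*} (s : ι → ℕ) (m : ℕ) : AddSubgroup (ι →₀ A) where
  carrier := {x | ∀ i, x i ∈ shiftDeg 𝒜 (s i) m}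
  zero_mem' := fun i => by simp
  add_mem' := fun hx hy i => by simpa using add_mem (hx i) (hy i)
  neg_mem' := fun hx i => by simpa using hx i

variable {𝒜 : ℕ → Submodule k A} {ι : Type*} {s : ι → ℕ}

theorem mem_freeDeg {m : ℕ} {x : ι →₀ A} :
    x ∈ freeDeg 𝒜 s m ↔ ∀ i, x i ∈ shiftDeg 𝒜 (s i) m := Iff.rfl

theorem mem_shiftDeg_add {s m : ℕ} {a : A} : a ∈ shiftDeg 𝒜 s (s + m) ↔ a ∈ 𝒜 m := by
  simp [shiftDeg]

theorem shiftDeg_of_lt {s m : ℕ} (h : m < s) : shiftDeg 𝒜 s m = ⊥ := by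
  simp [shiftDeg, h]

theorem mul_mem_shiftDeg [SetLike.GradedMonoid 𝒜] {s i j : ℕ} {a x : A} (ha : a ∈ 𝒜 i)
    (hx : x ∈ shiftDeg 𝒜 s j) : a * x ∈ shiftDeg 𝒜 s (i + j) := by
  rcases le_or_gt s j with h | h
  · obtain ⟨j, rfl⟩ := Nat.exists_eq_add_of_le h
    rw [mem_shiftDeg_add] at hx
    rw [Nat.add_left_comm, mem_shiftDeg_add]
    exact SetLike.mul_mem_graded ha hx
  · rw [shiftDeg_of_lt h, Submodule.mem_bot] at hx
    simp [hx]

theorem smul_mem_freeDeg [SetLike.GradedMonoid 𝒜] {i j : ℕ} {a : A} {x : ι →₀ A} (ha : a ∈ 𝒜 i)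
    (hx : x ∈ freeDeg 𝒜 s j) : a • x ∈ freeDeg 𝒜 s (i + j) := fun c =>
  mul_mem_shiftDeg ha (hx c)

theorem single_mem_freeDeg {i : ι} {m : ℕ} {a : A} (ha : a ∈ shiftDeg 𝒜 (s i) m) :
    Finsupp.single i a ∈ freeDeg 𝒜 s m := by
  classical
  intro j
  rw [Finsupp.single_apply]
  split_ifs with h
  · exact h ▸ ha
  · exact zero_mem _

theorem single_one_mem_freeDeg [SetLike.GradedMonoid 𝒜] (i : ι) :
    Finsupp.single i (1 : A) ∈ freeDeg 𝒜 s (s i) :=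
  single_mem_freeDeg ((mem_shiftDeg_add (m := 0)).2 SetLike.GradedOne.one_mem)

theorem span_freeDeg [SetLike.GradedMonoid 𝒜] (n : ℕ) :
    Submodule.span A (freeDeg 𝒜 (fun _ : ι => n) n : Set (ι →₀ A)) = ⊤ := by
  rw [eq_top_iff]
  rintro x -
  rw [← Finsupp.sum_single x]
  refine sum_mem fun i _ => ?_
  rw [← mul_one (x i), ← smul_eq_mul, ← Finsupp.smul_single]
  exact Submodule.smul_mem _ _ (Submodule.subset_span (single_one_mem_freeDeg (s := fun _ => n) i))

/-- The projection of `A(-s)` onto its component of degree `m`. -/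
def shiftProj (𝒜 : ℕ → Submodule k A) [GradedAlgebra 𝒜] (s m : ℕ) : A →+ A :=
  if s ≤ m then GradedRing.proj 𝒜 (m - s) else 0

theorem shiftProj_of_mem [GradedAlgebra 𝒜] {s l m : ℕ} {x : A} (hx : x ∈ shiftDeg 𝒜 s l) :
    shiftProj 𝒜 s m x = if l = m then x else 0 := by
  rcases le_or_gt s l with h | h
  · obtain ⟨l, rfl⟩ := Nat.exists_eq_add_of_le h
    rw [mem_shiftDeg_add] at hx
    unfold shiftProj
    split_ifs with h1 h2 h2
    · subst h2
      simp [GradedRing.proj_apply, decompose_of_mem_same _ hx]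
    · rw [GradedRing.proj_apply, decompose_of_mem_ne _ hx]
      omega
    · omega
    · simp
  · rw [shiftDeg_of_lt h, Submodule.mem_bot] at hx
    simp [hx]

/-- The projection of a graded free module onto its component of degree `m`. -/
noncomputable def freeProj (𝒜 : ℕ → Submodule k A) [GradedAlgebra 𝒜] (s : ι → ℕ) (m : ℕ) :
    (ι →₀ A) →+ (ι →₀ A) :=
  Finsupp.liftAddHom fun i => (Finsupp.singleAddHom i).comp (shiftProj 𝒜 (s i) m)

theorem freeProj_of_mem [GradedAlgebra 𝒜] {l m : ℕ} {x : ι →₀ A} (hx : x ∈ freeDeg 𝒜 s l) :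
    freeProj 𝒜 s m x = if l = m then x else 0 := by
  rw [freeProj, Finsupp.liftAddHom_apply, Finsupp.sum]
  simp only [AddMonoidHom.coe_comp, Function.comp_apply, Finsupp.singleAddHom_apply,
    shiftProj_of_mem (hx _)]
  split_ifs
  · exact Finsupp.sum_single x
  · simp

theorem closure_freeDeg [GradedAlgebra 𝒜] :
    AddSubmonoid.closure (⋃ m, (freeDeg 𝒜 s m : Set (ι →₀ A))) = ⊤ := by
  rw [eq_top_iff]
  rintro x -
  induction x using Finsupp.induction_linear with
  | zero => exact zero_mem _
  | add x y hx hy => exact add_mem hx hy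
  | single i a =>
    induction a using DirectSum.Decomposition.inductionOn 𝒜 with
    | zero => simp
    | @homogeneous j a =>
      refine AddSubmonoid.subset_closure (Set.mem_iUnion.2 ⟨s i + j, ?_⟩)
      exact single_mem_freeDeg (mem_shiftDeg_add.2 a.2)
    | add a b ha hb => rw [Finsupp.single_add]; exact add_mem ha hb

theorem isInternal_freeDeg [GradedAlgebra 𝒜] : IsInternal (freeDeg 𝒜 s) :=
  isInternal_of_projections _ (freeProj 𝒜 s) (fun _ _ _ hx => freeProj_of_mem hx) closure_freeDeg

end Free

/-! ### Linear covers and the resolution spliced from them. -/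

section GradedModules

/-- A module over a graded ring together with a family of additive subgroups compatible with
the action of homogeneous elements. -/
structure GMod {k : Type*} {A : Type u} [Field k] [Ring A] [Algebra k A]
    (𝒜 : ℕ → Submodule k A) where
  carrier : Type u
  [addCommGroup : AddCommGroup carrier]
  [module : Module A carrier]
  deg : ℕ → AddSubgroup carrier
  smul_mem : ∀ {i j : ℕ} {a : A} {x : carrier}, a ∈ 𝒜 i → x ∈ deg j → a • x ∈ deg (i + j)

attribute [instance] GMod.addCommGroup GMod.module

variable {k : Type*} {A : Type u} [Field k] [Ring A] [Algebra k A] {𝒜 : ℕ → Submodule k A}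

/-- The kernel of a linear map out of a graded free module generated in degree `n`. -/
noncomputable def kerGMod [SetLike.GradedMonoid 𝒜] (n : ℕ) {ι : Type u} {M : Type*}
    [AddCommGroup M] [Module A M]
    (π : (ι →₀ A) →ₗ[A] M) : GMod 𝒜 where
  carrier := LinearMap.ker π
  deg m := (freeDeg 𝒜 (fun _ : ι => n) m).comap (LinearMap.ker π).subtype.toAddMonoidHom
  smul_mem ha hx := smul_mem_freeDeg ha hx

/-- `M` is covered by a graded free module generated in degree `n`, with the kernel of the
covering map in `𝒞 (n + 1)`. -/
def HasLinearCover [SetLike.GradedMonoid 𝒜] (𝒞 : ℕ → GMod 𝒜 → Prop) (n : ℕ) (M : GMod 𝒜) : Prop :=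
  ∃ (ι : Type u) (π : (ι →₀ A) →ₗ[A] M.carrier),
    (∀ i, π (Finsupp.single i 1) ∈ M.deg n) ∧ Function.Surjective π ∧
    (∀ m, ∀ x ∈ M.deg m, ∃ y ∈ freeDeg 𝒜 (fun _ : ι => n) m, π y = x) ∧
    𝒞 (n + 1) (kerGMod n π)

theorem map_mem_deg {M : GMod 𝒜} {n : ℕ} {ι : Type*} (π : (ι →₀ A) →ₗ[A] M.carrier)
    (hπ : ∀ i, π (Finsupp.single i 1) ∈ M.deg n) {m : ℕ} {x : ι →₀ A}
    (hx : x ∈ freeDeg 𝒜 (fun _ : ι => n) m) : π x ∈ M.deg m := by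
  rw [← Finsupp.sum_single x, Finsupp.sum, map_sum]
  refine sum_mem fun i _ => ?_
  have hi := hx i
  rw [← mul_one (x i), ← smul_eq_mul, ← Finsupp.smul_single, map_smul]
  rcases le_or_gt n m with h | h
  · obtain ⟨m, rfl⟩ := Nat.exists_eq_add_of_le h
    rw [mem_shiftDeg_add] at hi
    rw [add_comm]
    exact M.smul_mem hi (hπ i)
  · rw [shiftDeg_of_lt h, Submodule.mem_bot] at hi
    simp [hi]

/-- `augmentationIdeal` is defined as a left ideal; this right absorption is what makes positive
degrees annihilate the trivial module. -/
theorem mul_mem_augmentationIdeal [GradedAlgebra 𝒜] {i : ℕ} (hi : 1 ≤ i) {a : A} (ha : a ∈ 𝒜 i)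
    (b : A) : a * b ∈ augmentationIdeal 𝒜 := by
  induction b using DirectSum.Decomposition.inductionOn 𝒜 with
  | zero => simp
  | @homogeneous j b =>
    exact Submodule.subset_span ⟨i + j, by omega, SetLike.mul_mem_graded ha b.2⟩
  | add b c hb hc => rw [mul_add]; exact add_mem hb hc

/-- The trivial module, concentrated in degree `0`. -/
def trivialGMod (𝒜 : ℕ → Submodule k A) [GradedAlgebra 𝒜] : GMod 𝒜 where
  carrier := TrivialModule 𝒜
  deg m := if m = 0 then ⊤ else ⊥
  smul_mem {i j a x} ha hx := by
    rcases Nat.eq_zero_or_pos j with rfl | hj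
    · rcases Nat.eq_zero_or_pos i with rfl | hi
      · simp
      · induction x using Submodule.Quotient.induction_on with
        | _ b =>
          rw [if_neg (by omega), AddSubgroup.mem_bot, ← Submodule.Quotient.mk_smul,
            Submodule.Quotient.mk_eq_zero]
          exact mul_mem_augmentationIdeal hi ha b
    · rw [if_neg hj.ne', AddSubgroup.mem_bot] at hx
      simp [hx]

section Resolution

variable [GradedAlgebra 𝒜] {𝒞 : ℕ → GMod 𝒜 → Prop}

/-- The iterated kernels of chosen covers, starting from the trivial module. -/
noncomputable def syzygy (h𝒞 : ∀ n M, 𝒞 n M → HasLinearCover 𝒞 n M) (h0 : 𝒞 0 (trivialGMod 𝒜)) :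
    (n : ℕ) → {M : GMod 𝒜 // 𝒞 n M}
  | 0 => ⟨trivialGMod 𝒜, h0⟩
  | n + 1 => ⟨kerGMod n (h𝒞 n _ (syzygy h𝒞 h0 n).2).choose_spec.choose,
      (h𝒞 n _ (syzygy h𝒞 h0 n).2).choose_spec.choose_spec.2.2.2⟩

/-- Each cover is followed by the inclusion of the kernel it covers into the previous free module;
exactness is then surjectivity of the covers. -/
theorem nonempty_resolution (h𝒞 : ∀ n M, 𝒞 n M → HasLinearCover 𝒞 n M)
    (h0 : 𝒞 0 (trivialGMod 𝒜)) : Nonempty (LinearProjectiveResolution 𝒜) := by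
  obtain ⟨X, ι, π, hX0, hXs, hπ, hs⟩ : ∃ (X : ℕ → GMod 𝒜) (ι : ℕ → Type u)
      (π : (n : ℕ) → (ι n →₀ A) →ₗ[A] (X n).carrier), X 0 = trivialGMod 𝒜 ∧
      (∀ n, X (n + 1) = kerGMod n (π n)) ∧ (∀ n i, π n (Finsupp.single i 1) ∈ (X n).deg n) ∧
      ∀ n, Function.Surjective (π n) :=
    let X := syzygy h𝒞 h0
    ⟨fun n => (X n).1, fun n => (h𝒞 n _ (X n).2).choose,
      fun n => (h𝒞 n _ (X n).2).choose_spec.choose, rfl, fun n => rfl,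
      fun n => (h𝒞 n _ (X n).2).choose_spec.choose_spec.1,
      fun n => (h𝒞 n _ (X n).2).choose_spec.choose_spec.2.1⟩
  -- The equality of `X (n + 1)` with a kernel is used only here, to extract the inclusion as a map,
  -- so that no transport along an equality of modules enters the resolution.
  have hj : ∀ n, ∃ j : (X (n + 1)).carrier →ₗ[A] (ι n →₀ A), LinearMap.ker j = ⊥ ∧
      LinearMap.range j = LinearMap.ker (π n) ∧
      ∀ m, ∀ x ∈ (X (n + 1)).deg m, j x ∈ freeDeg 𝒜 (fun _ : ι n => n) m := by
    intro n
    rw [hXs n]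
    exact ⟨(LinearMap.ker (π n)).subtype, Submodule.ker_subtype _, Submodule.range_subtype _,
      fun m x hx => hx⟩
  choose j hj0 hjr hjd using hj
  obtain ⟨e, he, hes, hed⟩ : ∃ e : (X 0).carrier →ₗ[A] TrivialModule 𝒜, LinearMap.ker e = ⊥ ∧
      Function.Surjective e ∧ ∀ m, ∀ x ∈ (X 0).deg m, 1 ≤ m → e x = 0 := by
    rw [hX0]
    refine ⟨(LinearMap.id : TrivialModule 𝒜 →ₗ[A] TrivialModule 𝒜), LinearMap.ker_id,
      Function.surjective_id, fun m x hx hm => ?_⟩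
    change x ∈ (if m = 0 then (⊤ : AddSubgroup (TrivialModule 𝒜)) else ⊥) at hx
    rw [if_neg (by omega)] at hx
    exact hx
  have hd : ∀ n, LinearMap.range (j n ∘ₗ π (n + 1)) = LinearMap.ker (π n) := by
    intro n
    rw [LinearMap.range_comp, LinearMap.range_eq_top.2 (hs (n + 1)), Submodule.map_top, hjr]
  have hk : ∀ n, LinearMap.ker (j n ∘ₗ π (n + 1)) = LinearMap.ker (π (n + 1)) := fun n =>
    LinearMap.ker_comp_of_ker_eq_bot _ (hj0 n)
  exact ⟨{
    P := fun n => ι n →₀ A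
    projective := fun n => inferInstance
    deg := fun n => freeDeg 𝒜 fun _ => n
    isInternal := fun n => isInternal_freeDeg
    smul_mem := fun n i j a x ha hx => smul_mem_freeDeg ha hx
    generated := fun n => span_freeDeg n
    d := fun n => j n ∘ₗ π (n + 1)
    d_mem := fun n m x hx => hjd n m _ (map_mem_deg (π (n + 1)) (hπ (n + 1)) hx)
    ε := e ∘ₗ π 0
    ε_eq_zero := fun m x hm hx => hed m _ (map_mem_deg (π 0) (hπ 0) hx) hm
    exact_d := fun n => LinearMap.exact_iff.2 ((hk n).trans (hd (n + 1)).symm)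
    exact_ε := LinearMap.exact_iff.2 ((LinearMap.ker_comp_of_ker_eq_bot _ he).trans (hd 0).symm)
    surjective_ε := hes.comp (hs 0) }⟩

end Resolution

end GradedModules

/-! ### The horseshoe lemma for linear covers. -/

section Horseshoe

variable {k : Type*} {A : Type u} [Field k] [Ring A] [Algebra k A] {𝒜 : ℕ → Submodule k A}

/-- `M` is an extension of `M''` by `M'`, exact in every degree. -/
def IsExtension (M' M M'' : GMod 𝒜) : Prop :=
  ∃ (f : M'.carrier →ₗ[A] M.carrier) (g : M.carrier →ₗ[A] M''.carrier),
    Function.Injective f ∧ (∀ x, g x = 0 ↔ x ∈ LinearMap.range f) ∧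
    (∀ m x, f x ∈ M.deg m ↔ x ∈ M'.deg m) ∧ Function.Surjective g ∧
    (∀ m, ∀ x ∈ M.deg m, g x ∈ M''.deg m) ∧
    (∀ m, ∀ y ∈ M''.deg m, ∃ x ∈ M.deg m, g x = y)

theorem mem_freeDeg_sumElim {ι ι' : Type*} {n m : ℕ} {x : ι →₀ A} {y : ι' →₀ A} :
    (Finsupp.sumFinsuppLEquivProdFinsupp A).symm (x, y) ∈ freeDeg 𝒜 (fun _ : ι ⊕ ι' => n) m ↔
      x ∈ freeDeg 𝒜 (fun _ : ι => n) m ∧ y ∈ freeDeg 𝒜 (fun _ : ι' => n) m := by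
  simp only [mem_freeDeg, Sum.forall]
  simp

/-- Generators of the cover of `M''` lift to `M` in the same degree `n`, and together with those of
`M'` they cover `M`. By the snake lemma the kernels again form an extension, so closure of `𝒞` under
extensions suffices. -/
theorem hasLinearCover_of_isExtension [SetLike.GradedMonoid 𝒜] {𝒞 : ℕ → GMod 𝒜 → Prop}
    (h𝒞 : ∀ n M' M M'', IsExtension M' M M'' → 𝒞 n M' → 𝒞 n M'' → 𝒞 n M)
    {n : ℕ} {M' M M'' : GMod 𝒜} (h : IsExtension M' M M'') (h' : HasLinearCover 𝒞 n M')
    (h'' : HasLinearCover 𝒞 n M'') : HasLinearCover 𝒞 n M := by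
  obtain ⟨f, g, hf, hfg, hfd, hg, hgd, hgs⟩ := h
  obtain ⟨ι', π', hπ', hs', hd', hc'⟩ := h'
  obtain ⟨ι'', π'', hπ'', hs'', hd'', hc''⟩ := h''
  choose v hv hgv using fun i => hgs n _ (hπ'' i)
  set L : (ι'' →₀ A) →ₗ[A] M.carrier := Finsupp.linearCombination A v with hL
  have hLd : ∀ {m x}, x ∈ freeDeg 𝒜 (fun _ : ι'' => n) m → L x ∈ M.deg m := fun hx =>
    map_mem_deg L (fun i => by simpa [hL] using hv i) hx
  have hgL : ∀ x, g (L x) = π'' x := by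
    intro x
    have : g ∘ₗ L = π'' := Finsupp.lhom_ext' fun i => LinearMap.ext_ring (by simp [hL, hgv])
    exact LinearMap.congr_fun this x
  have hgf : ∀ x, g (f x) = 0 := fun x => (hfg _).2 ⟨x, rfl⟩
  let S := Finsupp.sumFinsuppLEquivProdFinsupp (α := ι') (β := ι'') (M := A) A
  let π : (ι' ⊕ ι'' →₀ A) →ₗ[A] M.carrier := ((f ∘ₗ π').coprod L) ∘ₗ S.toLinearMap
  have hπS : ∀ x y, π (S.symm (x, y)) = f (π' x) + L y := by intro x y; simp [π]
  have hgπ : ∀ x y, g (π (S.symm (x, y))) = π'' y := by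
    intro x y; rw [hπS, map_add, hgf, hgL, zero_add]
  -- The error `x - L y` lies in `M'` and is homogeneous, so it is corrected by a homogeneous `w`.
  -- With `x = 0` this also lifts homogeneous elements of `ker π''` to `ker π`.
  have hfd' : ∀ m x y, y ∈ freeDeg 𝒜 (fun _ : ι'' => n) m → x ∈ M.deg m → g x = π'' y →
      ∃ w ∈ freeDeg 𝒜 (fun _ : ι' => n) m, π (S.symm (w, y)) = x := by
    intro m x y hy hx hxy
    obtain ⟨z, hz⟩ := (hfg (x - L y)).1 (by rw [map_sub, hgL, hxy, sub_self])
    have hzd : z ∈ M'.deg m := (hfd m z).1 (hz ▸ sub_mem hx (hLd hy))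
    obtain ⟨w, hw, rfl⟩ := hd' m z hzd
    exact ⟨w, hw, by rw [hπS, hz, sub_add_cancel]⟩
  refine ⟨ι' ⊕ ι'', π, ?_, ?_, ?_, ?_⟩
  · rintro (i | i)
    · have : Finsupp.single (Sum.inl i) 1 = S.symm (Finsupp.single i (1 : A), 0) := by
        simp [S]
      rw [this, hπS, map_zero, add_zero, hfd]
      exact hπ' i
    · have : Finsupp.single (Sum.inr i) 1 = S.symm (0, Finsupp.single i (1 : A)) := by
        simp [S]
      rw [this, hπS, map_zero, map_zero, zero_add]
      exact hLd (single_one_mem_freeDeg (s := fun _ => n) i)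
  · intro x
    obtain ⟨y, hy⟩ := hs'' (g x)
    obtain ⟨z, hz⟩ := (hfg (x - L y)).1 (by rw [map_sub, hgL, hy, sub_self])
    obtain ⟨w, rfl⟩ := hs' z
    exact ⟨S.symm (w, y), by rw [hπS, hz, sub_add_cancel]⟩
  · intro m x hx
    obtain ⟨y, hy, hyx⟩ := hd'' m _ (hgd m x hx)
    obtain ⟨w, hw, hwx⟩ := hfd' m x y hy hx hyx.symm
    exact ⟨_, mem_freeDeg_sumElim.2 ⟨hw, hy⟩, hwx⟩
  · refine h𝒞 (n + 1) (kerGMod n π') _ (kerGMod n π'') ?_ hc' hc''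
    let F : LinearMap.ker π' →ₗ[A] LinearMap.ker π :=
      (S.symm.toLinearMap ∘ₗ LinearMap.inl A _ _ ∘ₗ (LinearMap.ker π').subtype).codRestrict _
        (fun x => by
          change π (S.symm ((x : ι' →₀ A), 0)) = 0
          rw [hπS, map_zero, add_zero, LinearMap.mem_ker.1 x.2, map_zero])
    let G : LinearMap.ker π →ₗ[A] LinearMap.ker π'' :=
      (LinearMap.snd A _ _ ∘ₗ S.toLinearMap ∘ₗ (LinearMap.ker π).subtype).codRestrict _
        (fun x => by
          change π'' (S x).2 = 0
          rw [← hgπ (S x).1 (S x).2]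
          change g (π (S.symm (S x))) = 0
          rw [S.symm_apply_apply, LinearMap.mem_ker.1 x.2, map_zero])
    have hlift : ∀ y : ι'' →₀ A, ∀ w, π (S.symm (w, y)) = 0 → ∀ hy : y ∈ LinearMap.ker π'',
        ∃ x : LinearMap.ker π, (x : ι' ⊕ ι'' →₀ A) = S.symm (w, y) ∧ G x = ⟨y, hy⟩ := by
      intro y w hw hy
      refine ⟨⟨S.symm (w, y), hw⟩, rfl, Subtype.ext ?_⟩
      change (S (S.symm (w, y))).2 = y
      rw [S.apply_symm_apply]
    refine ⟨F, G, ?_, ?_, ?_, ?_, ?_, ?_⟩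
    · intro (x : LinearMap.ker π') (y : LinearMap.ker π') hxy
      have : S.symm ((x : ι' →₀ A), 0) = S.symm ((y : ι' →₀ A), 0) := congrArg Subtype.val hxy
      exact Subtype.ext (Prod.ext_iff.1 (S.symm.injective this)).1
    · intro (x : LinearMap.ker π)
      constructor
      · intro hx
        have h2 : (S (x : ι' ⊕ ι'' →₀ A)).2 = 0 := congrArg Subtype.val hx
        have hSx : (x : ι' ⊕ ι'' →₀ A) = S.symm ((S (x : ι' ⊕ ι'' →₀ A)).1, 0) := by
          rw [← h2]; exact (S.symm_apply_apply _).symm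
        have hx0 : π (x : ι' ⊕ ι'' →₀ A) = 0 := x.2
        refine ⟨⟨(S (x : ι' ⊕ ι'' →₀ A)).1, ?_⟩, Subtype.ext ?_⟩
        · rw [hSx, hπS, map_zero, add_zero] at hx0
          exact hf (hx0.trans (map_zero f).symm)
        · exact hSx.symm
      · rintro ⟨(y : LinearMap.ker π'), rfl⟩
        refine Subtype.ext ?_
        change (S (S.symm ((y : ι' →₀ A), 0))).2 = 0
        rw [S.apply_symm_apply]
    · intro m (x : LinearMap.ker π')
      change S.symm ((x : ι' →₀ A), 0) ∈ freeDeg 𝒜 _ m ↔ (x : ι' →₀ A) ∈ freeDeg 𝒜 _ m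
      rw [mem_freeDeg_sumElim]
      simp [zero_mem]
    · rintro ⟨y, hy⟩
      have : g (L y) = 0 := by rw [hgL]; exact hy
      obtain ⟨z, hz⟩ := (hfg _).1 this
      obtain ⟨w, rfl⟩ := hs' z
      obtain ⟨x, -, hx⟩ := hlift y (-w) (by rw [hπS, map_neg, map_neg, hz, neg_add_cancel]) hy
      exact ⟨x, hx⟩
    · intro m (x : LinearMap.ker π) hx
      have hx' : S.symm ((S (x : ι' ⊕ ι'' →₀ A)).1, (S (x : ι' ⊕ ι'' →₀ A)).2) ∈
          freeDeg 𝒜 (fun _ : ι' ⊕ ι'' => n) m := by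
        change S.symm (S (x : ι' ⊕ ι'' →₀ A)) ∈ _
        rw [S.symm_apply_apply]; exact hx
      exact (mem_freeDeg_sumElim.1 hx').2
    · rintro m ⟨y, hy⟩ hyd
      obtain ⟨w, hw, hwx⟩ := hfd' m 0 y hyd (zero_mem _) (by rw [map_zero]; exact hy.symm)
      obtain ⟨x, hx, hGx⟩ := hlift y w hwx hy
      refine ⟨x, ?_, hGx⟩
      change (x : ι' ⊕ ι'' →₀ A) ∈ freeDeg 𝒜 _ m
      rw [hx]
      exact mem_freeDeg_sumElim.2 ⟨hw, hyd⟩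

/-- `M` is graded free on generators of degree `n`. -/
def IsFreeGMod (n : ℕ) (M : GMod 𝒜) : Prop :=
  ∃ (ι : Type u) (π : (ι →₀ A) →ₗ[A] M.carrier), Function.Bijective π ∧
    ∀ m x, π x ∈ M.deg m ↔ x ∈ freeDeg 𝒜 (fun _ : ι => n) m

theorem isFreeGMod_of_subsingleton (n : ℕ) (M : GMod 𝒜) [Subsingleton M.carrier] :
    IsFreeGMod n M := by
  refine ⟨PEmpty, 0, ⟨Function.injective_of_subsingleton _, fun x => ⟨0, Subsingleton.elim _ _⟩⟩,
    fun m x => ?_⟩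
  simp only [LinearMap.zero_apply, zero_mem, Subsingleton.elim x 0]

theorem IsFreeGMod.hasLinearCover [SetLike.GradedMonoid 𝒜] {𝒞 : ℕ → GMod 𝒜 → Prop} {n : ℕ}
    {M : GMod 𝒜} (h𝒞 : ∀ n M, IsFreeGMod n M → 𝒞 n M) (h : IsFreeGMod n M) :
    HasLinearCover 𝒞 n M := by
  obtain ⟨ι, π, hπ, hd⟩ := h
  refine ⟨ι, π, fun i => (hd _ _).2 (single_one_mem_freeDeg (s := fun _ => n) i), hπ.2,
    fun m x hx => ?_, h𝒞 _ _ ?_⟩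
  · obtain ⟨y, rfl⟩ := hπ.2 x
    exact ⟨y, (hd m y).1 hx, rfl⟩
  · have : Subsingleton (kerGMod (𝒜 := 𝒜) n π).carrier := by
      change Subsingleton (LinearMap.ker π)
      rw [LinearMap.ker_eq_bot.2 hπ.1]
      infer_instance
    exact isFreeGMod_of_subsingleton _ _

end Horseshoe

/-! ### From a graded projective resolution over a connected algebra to linear free covers. -/

section Koszul

variable {k : Type*} {A : Type u} [Field k] [Ring A] [Algebra k A] {𝒜 : ℕ → Submodule k A}

/-- If `x` has no components below degree `d`, only the constant term of `h` can contribute to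
degree `d` of `x * h`. -/
theorem decompose_mul_of_forall_lt [GradedAlgebra 𝒜] {d : ℕ} {x : A}
    (hx : ∀ e < d, (decompose 𝒜 x e : A) = 0) (h : A) :
    (decompose 𝒜 (x * h) d : A) = decompose 𝒜 x d * decompose 𝒜 h 0 := by
  induction h using DirectSum.Decomposition.inductionOn 𝒜 with
  | zero => simp
  | @homogeneous e h =>
    rcases Nat.eq_zero_or_pos e with rfl | he
    · rw [coe_decompose_mul_of_right_mem_of_le 𝒜 h.2 (Nat.zero_le _),
        decompose_of_mem_same _ h.2, Nat.sub_zero]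
    · rw [decompose_of_mem_ne _ h.2 he.ne', mul_zero]
      rcases le_or_gt e d with hed | hed
      · rw [coe_decompose_mul_of_right_mem_of_le 𝒜 h.2 hed, hx _ (by omega), zero_mul]
      · exact coe_decompose_mul_of_right_mem_of_not_le 𝒜 h.2 (by omega)
  | add h h' ih ih' =>
    rw [mul_add, decompose_add, decompose_add]
    simp only [DirectSum.add_apply, Submodule.coe_add, mul_add, ih, ih']

/-- A graded projective module over a connected graded algebra that is generated in degree `n` is
graded free on generators of degree `n`. -/
theorem exists_free_of_projective [GradedAlgebra 𝒜]
    (h0 : 𝒜 0 = LinearMap.range (Algebra.linearMap k A))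
    {P : Type u} [AddCommGroup P] [Module A P] [Module.Projective A P] (deg : ℕ → AddSubgroup P)
    (hint : IsInternal deg) (smul_mem : ∀ i j (a : A) (x : P), a ∈ 𝒜 i → x ∈ deg j →
      a • x ∈ deg (i + j)) (n : ℕ) (hgen : Submodule.span A (deg n : Set P) = ⊤) :
    ∃ (ι : Type u) (e : (ι →₀ A) ≃ₗ[A] P),
      ∀ m x, e x ∈ deg m ↔ x ∈ freeDeg 𝒜 (fun _ : ι => n) m := by
  classical
  have hk : ∀ c : k, algebraMap k A c ∈ 𝒜 0 := fun c => by rw [h0]; exact ⟨c, rfl⟩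
  let _ : Module k P := Module.compHom P (algebraMap k A)
  have hsmul : ∀ (c : k) (x : P), c • x = algebraMap k A c • x := fun _ _ => rfl
  let V : Submodule k P := { deg n with
    smul_mem' := fun c x hx => by
      have := smul_mem 0 n _ x (hk c) hx
      rwa [Nat.zero_add] at this }
  -- The free generators are a `k`-basis of the degree `n` component.
  let b := Module.Basis.ofVectorSpace k V
  let ι := Module.Basis.ofVectorSpaceIndex k V
  let v : ι → P := fun i => (b i : P)
  have hvn : ∀ i, v i ∈ deg n := fun i => (b i).2
  have hv : LinearIndependent k v := b.linearIndependent.map' V.subtype (Submodule.ker_subtype V)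
  let M : GMod 𝒜 := { carrier := P, deg := deg, smul_mem := fun ha hx => smul_mem _ _ _ _ ha hx }
  let π : (ι →₀ A) →ₗ[A] P := Finsupp.linearCombination A v
  have hπ1 : ∀ i, π (Finsupp.single i 1) = v i := fun i => by simp [π]
  have hπd : ∀ m, ∀ x ∈ freeDeg 𝒜 (fun _ : ι => n) m, π x ∈ deg m := fun m x hx =>
    map_mem_deg (M := M) π (fun i => by rw [hπ1]; exact hvn i) hx
  have hsurj : Function.Surjective π := by
    rw [← LinearMap.range_eq_top, Finsupp.range_linearCombination, eq_top_iff, ← hgen,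
      Submodule.span_le]
    intro x hx
    have hx' := congrArg V.subtype (b.linearCombination_repr ⟨x, hx⟩)
    rw [Finsupp.linearCombination_apply, Finsupp.sum, map_sum] at hx'
    change _ = x at hx'
    rw [← hx']
    refine sum_mem fun i _ => ?_
    rw [map_smul, hsmul]
    exact Submodule.smul_mem _ _ (Submodule.subset_span ⟨i, rfl⟩)
  have hinj0 : ∀ z : ι →₀ A, (∀ i, z i ∈ 𝒜 0) → π z = 0 → z = 0 := by
    intro z hz hπz
    choose c hc using fun i => (h0 ▸ hz i : z i ∈ LinearMap.range (Algebra.linearMap k A))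
    have hc' : ∀ i, algebraMap k A (c i) = z i := hc
    have := linearIndependent_iff'.1 hv z.support c (by
      rw [← hπz]
      simp only [hsmul, hc']
      rfl)
    ext i
    by_cases hi : i ∈ z.support
    · rw [← hc', this i hi, map_zero, Finsupp.zero_apply]
    · simpa using hi
  let _ := hint.chooseDecomposition
  -- The generators have degree `n`, so the degree `n` part of `π y` sees only the constant terms of
  -- the coefficients.
  have hcomp : ∀ y : ι →₀ A, (decompose deg (π y) n : P) =
      π (y.mapRange (GradedRing.proj 𝒜 0) (map_zero _)) := by
    intro y
    induction y using Finsupp.induction_linear with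
    | zero => simp
    | add x y hx hy =>
      rw [Finsupp.mapRange_add (map_add _), π.map_add, π.map_add, decompose_add, ← hx, ← hy]; simp
    | single i a =>
      rw [Finsupp.mapRange_single]
      induction a using DirectSum.Decomposition.inductionOn 𝒜 with
      | zero => simp
      | @homogeneous j a =>
        have h1 : π (Finsupp.single i (a : A)) ∈ deg (j + n) := by
          simpa [π] using smul_mem _ _ _ _ a.2 (hvn i)
        by_cases hj : j = 0
        · subst hj
          rw [Nat.zero_add] at h1
          rw [decompose_of_mem_same _ h1, GradedRing.proj_apply, decompose_of_mem_same _ a.2]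
        · rw [decompose_of_mem_ne _ h1 (by omega), GradedRing.proj_apply,
            decompose_of_mem_ne _ a.2 hj]
          simp
      | add a a' ha ha' =>
        rw [Finsupp.single_add, π.map_add, (GradedRing.proj 𝒜 0).map_add, decompose_add,
          Finsupp.single_add, π.map_add, ← ha, ← ha']
        simp
  -- The section need not be graded: only the constant terms of its matrix are used, and `hs0` shows
  -- that they form the identity matrix.
  obtain ⟨s, hs⟩ := Module.projective_lifting_property π LinearMap.id hsurj
  have hs' : ∀ x, π (s x) = x := fun x => LinearMap.congr_fun hs x
  have hs0 : ∀ i j, (decompose 𝒜 (s (v i) j) 0 : A) = if i = j then 1 else 0 := by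
    intro i j
    have h1 : (s (v i)).mapRange (GradedRing.proj 𝒜 0) (map_zero _) - Finsupp.single i 1 = 0 := by
      refine hinj0 _ (fun j => ?_) ?_
      · rw [Finsupp.sub_apply, Finsupp.mapRange_apply, Finsupp.single_apply]
        refine sub_mem ?_ ?_
        · rw [GradedRing.proj_apply]; exact SetLike.coe_mem _
        · split_ifs
          · exact SetLike.GradedOne.one_mem
          · exact zero_mem _
      · rw [map_sub, ← hcomp, hs', decompose_of_mem_same _ (hvn i), hπ1, sub_self]
    have h2 := DFunLike.congr_fun h1 j
    rw [Finsupp.sub_apply, Finsupp.mapRange_apply, Finsupp.single_apply, Finsupp.zero_apply,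
      sub_eq_zero] at h2
    exact h2
  have hker : ∀ x, π x = 0 → x = 0 := by
    intro x hx
    have hsum : ∀ j, ∑ i ∈ x.support, x i * s (v i) j = 0 := by
      intro j
      have h1 : s (π x) = 0 := by rw [hx, map_zero]
      have h2 : π x = ∑ i ∈ x.support, x i • v i := rfl
      rw [h2, map_sum] at h1
      simpa [Finsupp.finsetSum_apply] using DFunLike.congr_fun h1 j
    -- Once all coefficients vanish below degree `d`, the degree `d` part of `∑ x i * s (v i) j = 0`
    -- reduces to the degree `d` part of `x j`, because the matrix is the identity in degree zero.
    have hd : ∀ d j, (decompose 𝒜 (x j) d : A) = 0 := by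
      intro d
      induction d using Nat.strong_induction_on with
      | _ d ih =>
        intro j
        have h1 : GradedRing.proj 𝒜 d (∑ i ∈ x.support, x i * s (v i) j) = 0 := by
          rw [hsum, map_zero]
        rw [map_sum] at h1
        simp only [GradedRing.proj_apply, decompose_mul_of_forall_lt (fun e he => ih e he _),
          hs0] at h1
        by_cases hj : j ∈ x.support
        · simpa [Finset.sum_ite_eq', hj] using h1
        · rw [Finsupp.notMem_support_iff.1 hj]; simp
    ext j
    refine (decompose 𝒜).injective (DFinsupp.ext fun d => Subtype.ext ?_)
    simpa using hd d j
  have hinj : Function.Injective π := (injective_iff_map_eq_zero π).2 hker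
  refine ⟨ι, LinearEquiv.ofBijective π ⟨hinj, hsurj⟩, fun m x => ⟨fun hx => ?_, hπd m x⟩⟩
  obtain ⟨y, hy, hyx⟩ := exists_homogeneous_preimage (ℳ := freeDeg 𝒜 fun _ : ι => n) (𝒩 := deg)
    isInternal_freeDeg hint π.toAddMonoidHom hπd hx
  rwa [← hinj hyx]

/-- `M` is graded isomorphic to the image of the linear map `δ`. -/
def IsGradedImage (M : GMod 𝒜) {P N : Type*} [AddCommGroup P] [Module A P] [AddCommGroup N]
    [Module A N] (deg : ℕ → AddSubgroup N) (δ : P →ₗ[A] N) : Prop :=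
  ∃ j : M.carrier →ₗ[A] N, Function.Injective j ∧ LinearMap.range j = LinearMap.range δ ∧
    ∀ m x, j x ∈ deg m ↔ x ∈ M.deg m

/-- Replacing `P` by an isomorphic free module, the kernel of the cover becomes `ker δ`, which by
exactness is the image of `δ'`, that is, the next syzygy. -/
theorem exists_cover_of_isGradedImage [GradedAlgebra 𝒜]
    (h0 : 𝒜 0 = LinearMap.range (Algebra.linearMap k A)) {M : GMod 𝒜}
    {P N Q : Type u} [AddCommGroup P] [Module A P] [Module.Projective A P] [AddCommGroup N]
    [Module A N] [AddCommGroup Q] [Module A Q] {degP : ℕ → AddSubgroup P}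
    {degN : ℕ → AddSubgroup N} (hP : IsInternal degP) (hN : IsInternal degN)
    (smul_mem : ∀ i j (a : A) (x : P), a ∈ 𝒜 i → x ∈ degP j → a • x ∈ degP (i + j)) (n : ℕ)
    (hgen : Submodule.span A (degP n : Set P) = ⊤)
    {δ : P →ₗ[A] N} (hδ : ∀ m, ∀ x ∈ degP m, δ x ∈ degN m) {δ' : Q →ₗ[A] P}
    (hex : Function.Exact δ' δ) (hM : IsGradedImage M degN δ) {𝒞 : ℕ → GMod 𝒜 → Prop}
    (h𝒞 : ∀ M, IsGradedImage M degP δ' → 𝒞 (n + 1) M) : HasLinearCover 𝒞 n M := by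
  obtain ⟨ι, e, he⟩ := exists_free_of_projective h0 degP hP smul_mem n hgen
  obtain ⟨j, hj, hjr, hjd⟩ := hM
  let J := LinearEquiv.ofInjective j hj
  let π : (ι →₀ A) →ₗ[A] M.carrier := J.symm.toLinearMap ∘ₗ
    (δ ∘ₗ e.toLinearMap).codRestrict _ (fun x => by rw [hjr]; exact ⟨e x, rfl⟩)
  have hjπ : ∀ x, j (π x) = δ (e x) := by
    intro x
    change ((J (J.symm _) : LinearMap.range j) : N) = _
    rw [J.apply_symm_apply]
    rfl
  refine ⟨ι, π, ?_, ?_, ?_, h𝒞 _ ?_⟩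
  · intro i
    rw [← hjd, hjπ]
    exact hδ _ _ ((he _ _).2 (single_one_mem_freeDeg (s := fun _ => n) i))
  · intro x
    obtain ⟨y, hy⟩ : j x ∈ LinearMap.range δ := hjr ▸ ⟨x, rfl⟩
    refine ⟨e.symm y, hj ?_⟩
    rw [hjπ, e.apply_symm_apply, hy]
  · intro m x hx
    obtain ⟨y, hy⟩ : j x ∈ LinearMap.range δ := hjr ▸ ⟨x, rfl⟩
    obtain ⟨z, hz, hzy⟩ := exists_homogeneous_preimage (x := y) (m := m) hP hN δ.toAddMonoidHom hδ
      (by change δ y ∈ _; rw [hy, hjd]; exact hx)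
    have hzy' : δ z = δ y := hzy
    refine ⟨e.symm z, ?_, hj ?_⟩
    · rw [← he, e.apply_symm_apply]; exact hz
    · rw [hjπ, e.apply_symm_apply, hzy', hy]
  · refine ⟨e.toLinearMap ∘ₗ (LinearMap.ker π).subtype,
      e.injective.comp Subtype.val_injective, ?_, fun m (x : LinearMap.ker π) => he m x⟩
    rw [← LinearMap.exact_iff.1 hex]
    ext y
    rw [LinearMap.mem_ker]
    constructor
    · rintro ⟨(x : LinearMap.ker π), rfl⟩
      change δ (e (x : ι →₀ A)) = 0
      have hx : π x = 0 := x.2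
      rw [← hjπ, hx, map_zero]
    · intro hy
      refine ⟨⟨e.symm y, hj ?_⟩, e.apply_symm_apply y⟩
      rw [hjπ, e.apply_symm_apply, hy, map_zero]

namespace LinearProjectiveResolution

attribute [local instance] addCommGroup module

/-- `M` is graded isomorphic to the `n`-th syzygy of the resolution `R`. -/
def IsSyzygy (R : LinearProjectiveResolution 𝒜) : ℕ → GMod 𝒜 → Prop
  | 0, M => IsGradedImage M (fun m => if m = 0 then ⊤ else ⊥) R.ε
  | n + 1, M => IsGradedImage M (R.deg n) (R.d n)

theorem IsSyzygy.hasLinearCover [GradedAlgebra 𝒜]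
    (h0 : 𝒜 0 = LinearMap.range (Algebra.linearMap k A)) (R : LinearProjectiveResolution 𝒜)
    (n : ℕ) (M : GMod 𝒜) (hM : R.IsSyzygy n M) : HasLinearCover R.IsSyzygy n M := by
  have := R.projective n
  cases n with
  | zero =>
    refine exists_cover_of_isGradedImage h0 (R.isInternal 0) (isInternal_concentrated _)
      (R.smul_mem 0) 0 (R.generated 0) ?_ R.exact_ε hM fun _ h => h
    intro m x hx
    split_ifs with hm
    · trivial
    · exact R.ε_eq_zero m x (by omega) hx
  | succ n =>
    exact exists_cover_of_isGradedImage h0 (R.isInternal (n + 1)) (R.isInternal n)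
      (R.smul_mem (n + 1)) (n + 1) (R.generated (n + 1)) (R.d_mem n) (R.exact_d n) hM fun _ h => h

theorem isSyzygy_trivialGMod [GradedAlgebra 𝒜] (R : LinearProjectiveResolution 𝒜) :
    R.IsSyzygy 0 (trivialGMod 𝒜) := by
  refine ⟨(LinearMap.id : TrivialModule 𝒜 →ₗ[A] TrivialModule 𝒜), Function.injective_id, ?_,
    fun m x => Iff.rfl⟩
  exact LinearMap.range_id.trans (LinearMap.range_eq_top.2 R.surjective_ε).symm

end LinearProjectiveResolution

end Koszul

/-! ### The grading of the double Ore extension. -/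

namespace IsTrimmedRightDoubleOreExtension

variable {k B : Type*} [Field k] [Ring B] [Algebra k B] {A : Subalgebra k B} {p q : k} {y₁ y₂ : B}
  {σ : A → Matrix (Fin 2) (Fin 2) A}

theorem y₂_mul_y₁ (h : IsTrimmedRightDoubleOreExtension A p q y₁ y₂ σ) :
    y₂ * y₁ = p • (y₁ * y₂) + q • y₁ ^ 2 := by
  simpa using h.relation

theorem y₁_mul_coe (h : IsTrimmedRightDoubleOreExtension A p q y₁ y₂ σ) (a : A) :
    y₁ * a = σ a 0 0 * y₁ + σ a 0 1 * y₂ := by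
  simpa using h.y₁_mul a

theorem y₂_mul_coe (h : IsTrimmedRightDoubleOreExtension A p q y₁ y₂ σ) (a : A) :
    y₂ * a = σ a 1 0 * y₁ + σ a 1 1 * y₂ := by
  simpa using h.y₂_mul a

theorem y₂_mul_y₁_pow (h : y₂ * y₁ = p • (y₁ * y₂) + q • y₁ ^ 2) (i : ℕ) :
    ∃ c : k, y₂ * y₁ ^ i = p ^ i • (y₁ ^ i * y₂) + c • y₁ ^ (i + 1) := by
  induction i with
  | zero => exact ⟨0, by simp⟩
  | succ i ih =>
    obtain ⟨c, hc⟩ := ih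
    refine ⟨p ^ i * q + c, ?_⟩
    rw [pow_succ, ← mul_assoc, hc, add_mul, smul_mul_assoc, mul_assoc, h, smul_mul_assoc,
      ← pow_succ, mul_add, mul_smul_comm, mul_smul_comm, smul_add, smul_smul, smul_smul,
      ← mul_assoc, ← pow_succ, ← pow_add, ← pow_succ, add_smul]
    abel

/-- The basis `y₁^i y₂^j` of `B` over `A`. -/
noncomputable def basis (h : IsTrimmedRightDoubleOreExtension A p q y₁ y₂ σ) :
    Module.Basis (ℕ × ℕ) A B :=
  Module.Basis.mk h.linearIndependent h.span_eq_top.ge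

theorem basis_apply (h : IsTrimmedRightDoubleOreExtension A p q y₁ y₂ σ) (i j : ℕ) :
    h.basis (i, j) = y₁ ^ i * y₂ ^ j :=
  Module.Basis.mk_apply _ _ _

section Grading

variable {𝒜 : ℕ → Submodule k A}

theorem coe_mul_mem_doubleOreGrading {m i j n : ℕ} (hn : m + i + j = n) {a : A} (ha : a ∈ 𝒜 m) :
    a • (y₁ ^ i * y₂ ^ j) ∈ doubleOreGrading A 𝒜 y₁ y₂ n :=
  Submodule.subset_span ⟨m, i, j, hn, a, ha, rfl⟩

/-- The grading of `B` is that of the graded free `A`-module with generators `y₁^i y₂^j` in degree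
`i + j`; the direct sum decomposition is transported from there. -/
theorem mem_doubleOreGrading_iff [SetLike.GradedMonoid 𝒜]
    (h : IsTrimmedRightDoubleOreExtension A p q y₁ y₂ σ) {n : ℕ} {x : B} :
    x ∈ doubleOreGrading A 𝒜 y₁ y₂ n ↔
      h.basis.repr x ∈ freeDeg 𝒜 (fun ij : ℕ × ℕ => ij.1 + ij.2) n := by
  constructor
  · intro hx
    induction hx using Submodule.span_induction with
    | mem x hx =>
      obtain ⟨m, i, j, rfl, a, ha, rfl⟩ := hx
      change h.basis.repr (a • (y₁ ^ i * y₂ ^ j)) ∈ _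
      rw [map_smul, ← h.basis_apply, Module.Basis.repr_self, Finsupp.smul_single, smul_eq_mul,
        mul_one]
      refine single_mem_freeDeg ?_
      rw [add_assoc, add_comm m]
      exact mem_shiftDeg_add.2 ha
    | zero => simp [zero_mem]
    | add x y _ _ hx hy => rw [map_add]; exact add_mem hx hy
    | smul c x _ hx =>
      rw [← algebraMap_smul A c x, map_smul, ← Nat.zero_add n]
      exact smul_mem_freeDeg (SetLike.algebraMap_mem_graded 𝒜 c) hx
  · intro hx
    rw [← h.basis.linearCombination_repr x, Finsupp.linearCombination_apply]
    refine sum_mem fun ij _ => ?_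
    change h.basis.repr x (ij.1, ij.2) • h.basis (ij.1, ij.2) ∈ _
    rw [h.basis_apply]
    have hij := hx ij
    rcases le_or_gt (ij.1 + ij.2) n with hn | hn
    · obtain ⟨m, rfl⟩ := Nat.exists_eq_add_of_le hn
      exact coe_mul_mem_doubleOreGrading (by omega) (mem_shiftDeg_add.1 hij)
    · rw [shiftDeg_of_lt hn, Submodule.mem_bot] at hij
      change h.basis.repr x (ij.1, ij.2) = 0 at hij
      rw [hij, zero_smul]
      exact zero_mem _

theorem isInternal_doubleOreGrading [GradedAlgebra 𝒜]
    (h : IsTrimmedRightDoubleOreExtension A p q y₁ y₂ σ) :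
    IsInternal (doubleOreGrading A 𝒜 y₁ y₂) := by
  refine isInternal_of_projections _ (fun m => h.basis.repr.symm.toAddMonoidHom.comp
    ((freeProj 𝒜 (fun ij : ℕ × ℕ => ij.1 + ij.2) m).comp h.basis.repr.toAddMonoidHom)) ?_ ?_
  · intro m l x hx
    change h.basis.repr.symm (freeProj 𝒜 _ m (h.basis.repr x)) = _
    rw [freeProj_of_mem (h.mem_doubleOreGrading_iff.1 hx)]
    split_ifs <;> simp
  · have key := closure_freeDeg (𝒜 := 𝒜) (s := fun ij : ℕ × ℕ => ij.1 + ij.2)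
    rw [eq_top_iff] at key ⊢
    have hle : AddSubmonoid.closure (⋃ m, (freeDeg 𝒜 (fun ij : ℕ × ℕ => ij.1 + ij.2) m :
        Set (ℕ × ℕ →₀ A))) ≤ (AddSubmonoid.closure
          (⋃ m, (doubleOreGrading A 𝒜 y₁ y₂ m : Set B))).comap
            h.basis.repr.symm.toAddMonoidHom := by
      rw [AddSubmonoid.closure_le]
      intro z hz
      obtain ⟨m, hm⟩ := Set.mem_iUnion.1 hz
      refine AddSubmonoid.subset_closure (Set.mem_iUnion.2 ⟨m, ?_⟩)
      change h.basis.repr.symm z ∈ doubleOreGrading A 𝒜 y₁ y₂ m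
      rw [h.mem_doubleOreGrading_iff, LinearEquiv.apply_symm_apply]
      exact hm
    intro x _
    have hx : h.basis.repr.symm (h.basis.repr x) ∈ AddSubmonoid.closure
        (⋃ m, (doubleOreGrading A 𝒜 y₁ y₂ m : Set B)) :=
      hle (key (AddSubmonoid.mem_top (h.basis.repr x)))
    rwa [LinearEquiv.symm_apply_apply] at hx

theorem coe_mem_doubleOreGrading {n : ℕ} {a : A} (ha : a ∈ 𝒜 n) :
    (a : B) ∈ doubleOreGrading A 𝒜 y₁ y₂ n := by
  have : a • (y₁ ^ 0 * y₂ ^ 0) ∈ doubleOreGrading A 𝒜 y₁ y₂ n :=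
    coe_mul_mem_doubleOreGrading (by omega) ha
  simpa [Subalgebra.smul_def] using this

theorem y₁_mem_doubleOreGrading [SetLike.GradedMonoid 𝒜] :
    y₁ ∈ doubleOreGrading A 𝒜 y₁ y₂ 1 := by
  have : (1 : A) • (y₁ ^ 1 * y₂ ^ 0) ∈ doubleOreGrading A 𝒜 y₁ y₂ 1 :=
    coe_mul_mem_doubleOreGrading (by omega) (SetLike.GradedOne.one_mem (A := 𝒜))
  simpa using this

theorem y₂_mem_doubleOreGrading [SetLike.GradedMonoid 𝒜] :
    y₂ ∈ doubleOreGrading A 𝒜 y₁ y₂ 1 := by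
  have : (1 : A) • (y₁ ^ 0 * y₂ ^ 1) ∈ doubleOreGrading A 𝒜 y₁ y₂ 1 :=
    coe_mul_mem_doubleOreGrading (by omega) (SetLike.GradedOne.one_mem (A := 𝒜))
  simpa using this

theorem smul_mem_doubleOreGrading [SetLike.GradedMonoid 𝒜] {m n : ℕ} {a : A} {x : B}
    (ha : a ∈ 𝒜 m) (hx : x ∈ doubleOreGrading A 𝒜 y₁ y₂ n) :
    a • x ∈ doubleOreGrading A 𝒜 y₁ y₂ (m + n) := by
  induction hx using Submodule.span_induction with
  | mem x hx =>
    obtain ⟨l, i, j, rfl, b, hb, rfl⟩ := hx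
    change a • b • (y₁ ^ i * y₂ ^ j) ∈ _
    rw [smul_smul]
    exact coe_mul_mem_doubleOreGrading (by omega) (SetLike.mul_mem_graded ha hb)
  | zero => rw [smul_zero]; exact zero_mem _
  | add x y _ _ hx hy => rw [smul_add]; exact add_mem hx hy
  | smul c x _ hx => rw [smul_comm]; exact Submodule.smul_mem _ _ hx

theorem y₁_mul_mem_doubleOreGrading [SetLike.GradedMonoid 𝒜]
    (h : IsTrimmedRightDoubleOreExtension A p q y₁ y₂ σ)
    (hσ : ∀ n, ∀ a ∈ 𝒜 n, ∀ i j, σ a i j ∈ 𝒜 n) {n : ℕ} {x : B}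
    (hx : x ∈ doubleOreGrading A 𝒜 y₁ y₂ n) : y₁ * x ∈ doubleOreGrading A 𝒜 y₁ y₂ (n + 1) := by
  induction hx using Submodule.span_induction with
  | mem x hx =>
    obtain ⟨l, i, j, rfl, b, hb, rfl⟩ := hx
    obtain ⟨c, hc⟩ := y₂_mul_y₁_pow h.y₂_mul_y₁ i
    have e : y₁ * (b * (y₁ ^ i * y₂ ^ j)) = σ b 0 0 • (y₁ ^ (i + 1) * y₂ ^ j) +
        (p ^ i • σ b 0 1 • (y₁ ^ i * y₂ ^ (j + 1)) + c • σ b 0 1 • (y₁ ^ (i + 1) * y₂ ^ j)) := by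
      rw [← mul_assoc, h.y₁_mul_coe, add_mul, mul_assoc, ← mul_assoc y₁, ← pow_succ',
        mul_assoc, ← mul_assoc y₂, hc, add_mul, smul_mul_assoc, mul_assoc, ← pow_succ', mul_add,
        smul_mul_assoc, mul_smul_comm, mul_smul_comm]
      rfl
    rw [e]
    have h0 := hσ _ _ hb 0 0
    have h1 := hσ _ _ hb 0 1
    exact add_mem (coe_mul_mem_doubleOreGrading (by omega) h0) (add_mem
      (Submodule.smul_mem _ _ (coe_mul_mem_doubleOreGrading (by omega) h1))
      (Submodule.smul_mem _ _ (coe_mul_mem_doubleOreGrading (by omega) h1)))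
  | zero => rw [mul_zero]; exact zero_mem _
  | add x y _ _ hx hy => rw [mul_add]; exact add_mem hx hy
  | smul c x _ hx => rw [mul_smul_comm]; exact Submodule.smul_mem _ _ hx

theorem y₂_mul_mem_doubleOreGrading [SetLike.GradedMonoid 𝒜]
    (h : IsTrimmedRightDoubleOreExtension A p q y₁ y₂ σ)
    (hσ : ∀ n, ∀ a ∈ 𝒜 n, ∀ i j, σ a i j ∈ 𝒜 n) {n : ℕ} {x : B}
    (hx : x ∈ doubleOreGrading A 𝒜 y₁ y₂ n) : y₂ * x ∈ doubleOreGrading A 𝒜 y₁ y₂ (n + 1) := by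
  induction hx using Submodule.span_induction with
  | mem x hx =>
    obtain ⟨l, i, j, rfl, b, hb, rfl⟩ := hx
    obtain ⟨c, hc⟩ := y₂_mul_y₁_pow h.y₂_mul_y₁ i
    have e : y₂ * (b * (y₁ ^ i * y₂ ^ j)) = σ b 1 0 • (y₁ ^ (i + 1) * y₂ ^ j) +
        (p ^ i • σ b 1 1 • (y₁ ^ i * y₂ ^ (j + 1)) + c • σ b 1 1 • (y₁ ^ (i + 1) * y₂ ^ j)) := by
      rw [← mul_assoc, h.y₂_mul_coe, add_mul, mul_assoc, ← mul_assoc y₁, ← pow_succ',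
        mul_assoc, ← mul_assoc y₂, hc, add_mul, smul_mul_assoc, mul_assoc, ← pow_succ', mul_add,
        smul_mul_assoc, mul_smul_comm, mul_smul_comm]
      rfl
    rw [e]
    have h0 := hσ _ _ hb 1 0
    have h1 := hσ _ _ hb 1 1
    exact add_mem (coe_mul_mem_doubleOreGrading (by omega) h0) (add_mem
      (Submodule.smul_mem _ _ (coe_mul_mem_doubleOreGrading (by omega) h1))
      (Submodule.smul_mem _ _ (coe_mul_mem_doubleOreGrading (by omega) h1)))
  | zero => rw [mul_zero]; exact zero_mem _
  | add x y _ _ hx hy => rw [mul_add]; exact add_mem hx hy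
  | smul c x _ hx => rw [mul_smul_comm]; exact Submodule.smul_mem _ _ hx

theorem gradedMonoid_doubleOreGrading [SetLike.GradedMonoid 𝒜]
    (h : IsTrimmedRightDoubleOreExtension A p q y₁ y₂ σ)
    (hσ : ∀ n, ∀ a ∈ 𝒜 n, ∀ i j, σ a i j ∈ 𝒜 n) :
    SetLike.GradedMonoid (doubleOreGrading A 𝒜 y₁ y₂) where
  one_mem := coe_mem_doubleOreGrading (SetLike.GradedOne.one_mem (A := 𝒜))
  mul_mem := by
    intro m n x y hx hy
    -- A left factor `a y₁^i y₂^j` is applied one letter at a time, from its right end.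
    have hy₂ : ∀ j, y₂ ^ j * y ∈ doubleOreGrading A 𝒜 y₁ y₂ (n + j) := by
      intro j
      induction j with
      | zero => simpa using hy
      | succ j ih =>
        rw [pow_succ', mul_assoc]
        exact h.y₂_mul_mem_doubleOreGrading hσ ih
    have hy₁ : ∀ i j, y₁ ^ i * (y₂ ^ j * y) ∈ doubleOreGrading A 𝒜 y₁ y₂ (n + j + i) := by
      intro i j
      induction i with
      | zero => simpa using hy₂ j
      | succ i ih =>
        rw [pow_succ', mul_assoc]
        exact h.y₁_mul_mem_doubleOreGrading hσ ih
    induction hx using Submodule.span_induction with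
    | mem x hx =>
      obtain ⟨l, i, j, rfl, b, hb, rfl⟩ := hx
      rw [mul_assoc, mul_assoc, (by omega : l + i + j + n = l + (n + j + i))]
      exact smul_mem_doubleOreGrading hb (hy₁ i j)
    | zero => rw [zero_mul]; exact zero_mem _
    | add x x' _ _ hx hx' => rw [add_mul]; exact add_mem hx hx'
    | smul c x _ hx => rw [smul_mul_assoc]; exact Submodule.smul_mem _ _ hx

theorem isGradedAlgebra_doubleOreGrading [GradedAlgebra 𝒜]
    (h : IsTrimmedRightDoubleOreExtension A p q y₁ y₂ σ)
    (hσ : ∀ n, ∀ a ∈ 𝒜 n, ∀ i j, σ a i j ∈ 𝒜 n) :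
    IsGradedAlgebra (doubleOreGrading A 𝒜 y₁ y₂) := by
  have := h.gradedMonoid_doubleOreGrading hσ
  exact ⟨{ this, h.isInternal_doubleOreGrading.chooseDecomposition with }⟩

theorem map_mem_shiftDeg [SetLike.GradedMonoid 𝒜] {s : ℕ} (f : B →ₗ[A] B)
    (hf : ∀ i j, f (y₁ ^ i * y₂ ^ j) ∈ shiftDeg (doubleOreGrading A 𝒜 y₁ y₂) s (i + j))
    {n : ℕ} {x : B} (hx : x ∈ doubleOreGrading A 𝒜 y₁ y₂ n) :
    f x ∈ shiftDeg (doubleOreGrading A 𝒜 y₁ y₂) s n := by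
  induction hx using Submodule.span_induction with
  | mem x hx =>
    obtain ⟨m, i, j, rfl, a, ha, rfl⟩ := hx
    change f (a • (y₁ ^ i * y₂ ^ j)) ∈ _
    rw [map_smul]
    have hij := hf i j
    rcases le_or_gt s (i + j) with hs | hs
    · obtain ⟨l, hl⟩ := Nat.exists_eq_add_of_le hs
      rw [hl, mem_shiftDeg_add] at hij
      rw [add_assoc, hl, add_left_comm, mem_shiftDeg_add]
      exact smul_mem_doubleOreGrading ha hij
    · rw [shiftDeg_of_lt hs, Submodule.mem_bot] at hij
      rw [hij, smul_zero]
      exact zero_mem _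
  | zero => rw [map_zero]; exact zero_mem _
  | add x y _ _ hx hy => rw [map_add]; exact add_mem hx hy
  | smul c x _ hx =>
    rw [← algebraMap_smul A c x, map_smul, algebraMap_smul]; exact Submodule.smul_mem _ _ hx

end Grading

end IsTrimmedRightDoubleOreExtension

/-! ### Division operators, the retraction onto `A`, and exactness of the length-two resolution. -/

namespace IsTrimmedRightDoubleOreExtension

variable {k B : Type*} [Field k] [Ring B] [Algebra k B] {A : Subalgebra k B} {p q : k} {y₁ y₂ : B}
  {σ : A → Matrix (Fin 2) (Fin 2) A}

section Operators

variable (h : IsTrimmedRightDoubleOreExtension A p q y₁ y₂ σ)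

/-- The left `A`-linear map that divides the monomials `y₁^i y₂^j` with `j > 0` by `y₂`
and kills the powers of `y₁`. -/
noncomputable def divY₂ : B →ₗ[A] B :=
  h.basis.constr ℕ fun ij => if ij.2 = 0 then 0 else y₁ ^ ij.1 * y₂ ^ (ij.2 - 1)

/-- The left `A`-linear map that divides the powers `y₁^i` with `i > 0` by `y₁` and kills all other
monomials. -/
noncomputable def divY₁ : B →ₗ[A] B :=
  h.basis.constr ℕ fun ij => if ij.2 = 0 ∧ ij.1 ≠ 0 then y₁ ^ (ij.1 - 1) else 0

theorem constr_monomial {M : Type*} [AddCommMonoid M] [Module A M] (f : ℕ × ℕ → M) (i j : ℕ) :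
    h.basis.constr ℕ f (y₁ ^ i * y₂ ^ j) = f (i, j) := by
  rw [← h.basis_apply, Module.Basis.constr_basis]

theorem divY₂_pow (i : ℕ) : h.divY₂ (y₁ ^ i) = 0 := by
  rw [← mul_one (y₁ ^ i), ← pow_zero y₂, divY₂, constr_monomial, if_pos rfl]

theorem divY₂_succ (i j : ℕ) : h.divY₂ (y₁ ^ i * y₂ ^ (j + 1)) = y₁ ^ i * y₂ ^ j := by
  simp [divY₂, constr_monomial]

theorem divY₁_pow_succ (i : ℕ) : h.divY₁ (y₁ ^ (i + 1)) = y₁ ^ i := by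
  rw [← mul_one (y₁ ^ (i + 1)), ← pow_zero y₂, divY₁, constr_monomial]
  simp

theorem divY₁_one : h.divY₁ 1 = 0 := by
  have h1 : (1 : B) = y₁ ^ 0 * y₂ ^ 0 := by simp
  rw [h1, divY₁, constr_monomial]
  simp

theorem divY₁_mul_pow_succ (i j : ℕ) : h.divY₁ (y₁ ^ i * y₂ ^ (j + 1)) = 0 := by
  simp [divY₁, constr_monomial]

theorem hom_ext (h : IsTrimmedRightDoubleOreExtension A p q y₁ y₂ σ) {M : Type*} [AddCommMonoid M]
    [Module A M] {f g : B →ₗ[A] M}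
    (hfg : ∀ i j, f (y₁ ^ i * y₂ ^ j) = g (y₁ ^ i * y₂ ^ j)) (x : B) : f x = g x := by
  have : f = g := h.basis.ext fun ij => by
    change f (h.basis (ij.1, ij.2)) = g (h.basis (ij.1, ij.2))
    rw [h.basis_apply, hfg]
  rw [this]

theorem divY₂_mul_y₂ (x : B) : h.divY₂ (x * y₂) = x :=
  h.hom_ext (f := h.divY₂ ∘ₗ LinearMap.mulRight A y₂) (g := LinearMap.id) (fun i j => by
    change h.divY₂ (y₁ ^ i * y₂ ^ j * y₂) = _
    rw [mul_assoc, ← pow_succ, h.divY₂_succ]; rfl) x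

/-- The coefficient of `1`. -/
noncomputable def coeffOne : B →ₗ[A] A := h.basis.coord (0, 0)

theorem coeffOne_monomial (i j : ℕ) :
    h.coeffOne (y₁ ^ i * y₂ ^ j) = if i = 0 ∧ j = 0 then 1 else 0 := by
  rw [← h.basis_apply, coeffOne, Module.Basis.coord_apply, Module.Basis.repr_self,
    Finsupp.single_apply]
  simp

theorem coeffOne_pow (i : ℕ) : h.coeffOne (y₁ ^ i) = if i = 0 then 1 else 0 := by
  simpa using h.coeffOne_monomial i 0

/-- A basis monomial either ends in `y₂`, or is a positive power of `y₁`, or is `1`; the three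
summands collect these cases. -/
theorem coeffOne_add (x : B) :
    (h.coeffOne x : B) + h.divY₁ x * y₁ + h.divY₂ x * y₂ = x := by
  have key := h.hom_ext (f := LinearMap.toSpanSingleton A B 1 ∘ₗ h.coeffOne +
    LinearMap.mulRight A y₁ ∘ₗ h.divY₁ + LinearMap.mulRight A y₂ ∘ₗ h.divY₂) (g := LinearMap.id)
    (fun i j => by
      change h.coeffOne (y₁ ^ i * y₂ ^ j) • (1 : B) + h.divY₁ (y₁ ^ i * y₂ ^ j) * y₁ +
        h.divY₂ (y₁ ^ i * y₂ ^ j) * y₂ = y₁ ^ i * y₂ ^ j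
      rcases j with _ | j
      · rw [pow_zero, mul_one, h.divY₂_pow, h.coeffOne_pow]
        rcases i with _ | i
        · simp [h.divY₁_one]
        · rw [h.divY₁_pow_succ, ← pow_succ]
          simp
      · rw [h.divY₁_mul_pow_succ, h.divY₂_succ, h.coeffOne_monomial]
        simp [pow_succ, mul_assoc]) x
  have h1 : (h.coeffOne x : B) = h.coeffOne x • (1 : B) := by
    rw [Subalgebra.smul_def, smul_eq_mul, mul_one]
  rw [h1]
  exact key

theorem coeffOne_coe (a : A) : h.coeffOne (a : B) = a := by
  have h1 : (a : B) = a • (y₁ ^ 0 * y₂ ^ 0) := by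
    rw [Subalgebra.smul_def, smul_eq_mul, pow_zero, pow_zero, mul_one, mul_one]
  rw [h1, map_smul, h.coeffOne_monomial]
  simp

theorem coeffOne_y₂_mul_monomial (i j : ℕ) : h.coeffOne (y₂ * (y₁ ^ i * y₂ ^ j)) = 0 := by
  obtain ⟨c, hc⟩ := y₂_mul_y₁_pow h.y₂_mul_y₁ i
  rw [← mul_assoc, hc, add_mul, smul_mul_assoc, smul_mul_assoc, mul_assoc, ← pow_succ', map_add,
    LinearMap.map_smul_of_tower, LinearMap.map_smul_of_tower, h.coeffOne_monomial,
    h.coeffOne_monomial]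
  simp

theorem coeffOne_y₁_mul_monomial (i j : ℕ) : h.coeffOne (y₁ * (y₁ ^ i * y₂ ^ j)) = 0 := by
  rw [← mul_assoc, ← pow_succ', h.coeffOne_monomial]
  simp

/-- With `z` equal to `y₁` or `y₂`: after `z` is moved past `b`, a letter `y₁` or `y₂` still stands
to the left of the monomial, and straightening it never produces the monomial `1`. -/
theorem coeffOne_mul_smul_monomial (z : B) (b : A) (i j : ℕ)
    (hz : ∃ c d : A, z * b = c * y₁ + d * y₂) : h.coeffOne (z * b • (y₁ ^ i * y₂ ^ j)) = 0 := by
  obtain ⟨c, d, hcd⟩ := hz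
  have e : z * b • (y₁ ^ i * y₂ ^ j) = c • (y₁ * (y₁ ^ i * y₂ ^ j)) +
      d • (y₂ * (y₁ ^ i * y₂ ^ j)) := by
    simp only [Subalgebra.smul_def, smul_eq_mul]
    rw [← mul_assoc, hcd, add_mul, mul_assoc, mul_assoc]
  rw [e, map_add, map_smul, map_smul, coeffOne_y₂_mul_monomial, coeffOne_y₁_mul_monomial,
    smul_zero, smul_zero, add_zero]

theorem induction_on (h : IsTrimmedRightDoubleOreExtension A p q y₁ y₂ σ) {motive : B → Prop}
    (add : ∀ x y, motive x → motive y → motive (x + y)) (zero : motive 0)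
    (monomial : ∀ (a : A) (i j : ℕ), motive (a • (y₁ ^ i * y₂ ^ j))) (x : B) : motive x := by
  rw [← h.basis.linearCombination_repr x, Finsupp.linearCombination_apply, Finsupp.sum]
  refine Finset.sum_induction _ motive add zero fun ij _ => ?_
  change motive (h.basis.repr x ij • h.basis (ij.1, ij.2))
  rw [h.basis_apply]
  exact monomial _ _ _

theorem coeffOne_y₁_mul (x : B) : h.coeffOne (y₁ * x) = 0 := by
  induction x using h.induction_on with
  | add x y hx hy => rw [mul_add, map_add, hx, hy, add_zero]
  | zero => simp
  | monomial a i j => exact h.coeffOne_mul_smul_monomial _ _ _ _ ⟨_, _, h.y₁_mul_coe a⟩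

theorem coeffOne_y₂_mul (x : B) : h.coeffOne (y₂ * x) = 0 := by
  induction x using h.induction_on with
  | add x y hx hy => rw [mul_add, map_add, hx, hy, add_zero]
  | zero => simp
  | monomial a i j => exact h.coeffOne_mul_smul_monomial _ _ _ _ ⟨_, _, h.y₂_mul_coe a⟩

/-- The algebra retraction `B → A` that kills `y₁` and `y₂`. -/
noncomputable def retraction : B →+* A where
  toFun := h.coeffOne
  map_one' := by simpa using h.coeffOne_coe 1
  map_zero' := map_zero _
  map_add' := map_add _
  map_mul' x y := by
    have e : x * y = h.coeffOne x • y + h.divY₁ x * (y₁ * y) + h.divY₂ x * (y₂ * y) := by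
      nth_rw 1 [← h.coeffOne_add x]
      rw [add_mul, add_mul, mul_assoc, mul_assoc]
      rfl
    -- A monomial of `b` is either `1`, where the assumption on `z` applies, or begins with `y₁` or
    -- `y₂`, which already kills the coefficient.
    have hz : ∀ b z : B, (∀ x, h.coeffOne (z * x) = 0) → h.coeffOne (b * (z * y)) = 0 := by
      intro b z hz
      induction b using h.induction_on with
      | add x y hx hy => rw [add_mul, map_add, hx, hy, add_zero]
      | zero => simp
      | monomial a i j =>
        rw [smul_mul_assoc, map_smul]
        have : h.coeffOne (y₁ ^ i * y₂ ^ j * (z * y)) = 0 := by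
          rcases i with _ | i
          · rcases j with _ | j
            · simpa using hz y
            · rw [pow_zero, one_mul, pow_succ', mul_assoc]; exact h.coeffOne_y₂_mul _
          · rw [pow_succ', mul_assoc, mul_assoc]; exact h.coeffOne_y₁_mul _
        rw [this, smul_zero]
    rw [e, map_add, map_add, map_smul, hz _ _ h.coeffOne_y₁_mul, hz _ _ h.coeffOne_y₂_mul]
    simp

theorem retraction_coe (a : A) : h.retraction (a : B) = a := h.coeffOne_coe a

theorem retraction_y₁ : h.retraction y₁ = 0 :=
  (congrArg h.coeffOne (mul_one y₁)).symm.trans (h.coeffOne_y₁_mul 1)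

theorem retraction_y₂ : h.retraction y₂ = 0 :=
  (congrArg h.coeffOne (mul_one y₂)).symm.trans (h.coeffOne_y₂_mul 1)

theorem eq_add_of_retraction_eq_zero {x : B} (hx : h.retraction x = 0) :
    h.divY₁ x * y₁ + h.divY₂ x * y₂ = x := by
  have := h.coeffOne_add x
  change ((h.retraction x : A) : B) + _ + _ = x at this
  rwa [hx, ZeroMemClass.coe_zero, zero_add] at this

/-- The left `A`-submodule of the elements of degree less than `n` in `y₂`. -/
def y₂Filtration (A : Subalgebra k B) (y₁ y₂ : B) (n : ℕ) : Submodule A B :=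
  Submodule.span A {b | ∃ i j, j < n ∧ b = y₁ ^ i * y₂ ^ j}

theorem monomial_mem_y₂Filtration {i j n : ℕ} (hj : j < n) :
    y₁ ^ i * y₂ ^ j ∈ y₂Filtration A y₁ y₂ n := Submodule.subset_span ⟨i, j, hj, rfl⟩

theorem y₂Filtration_mono {m n : ℕ} (hmn : m ≤ n) :
    y₂Filtration A y₁ y₂ m ≤ y₂Filtration A y₁ y₂ n :=
  Submodule.span_mono fun _ ⟨i, j, hj, e⟩ => ⟨i, j, hj.trans_le hmn, e⟩

theorem map_mem_y₂Filtration (f : B →ₗ[A] B) {m n : ℕ}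
    (hf : ∀ i, ∀ j < m, f (y₁ ^ i * y₂ ^ j) ∈ y₂Filtration A y₁ y₂ n) {x : B}
    (hx : x ∈ y₂Filtration A y₁ y₂ m) : f x ∈ y₂Filtration A y₁ y₂ n := by
  have : y₂Filtration A y₁ y₂ m ≤ (y₂Filtration A y₁ y₂ n).comap f :=
    Submodule.span_le.2 fun _ ⟨i, j, hj, e⟩ => e ▸ hf i j hj
  exact this hx

/-- The hypothesis says that `x` is a left combination of powers of `y₁` alone, where both claims
are immediate. -/
theorem divY₂_mul_y₁_of_divY₂_eq_zero {x : B} (hx : h.divY₂ x = 0) :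
    h.divY₂ (x * y₁) = 0 ∧ h.divY₁ (x * y₁) = x := by
  have h1 : ∀ z : B, z - h.divY₂ z * y₂ ∈ y₂Filtration A y₁ y₂ 1 := by
    intro z
    induction z using h.induction_on with
    | add x y hx hy =>
      rw [map_add, add_mul, add_sub_add_comm]
      exact add_mem hx hy
    | zero => rw [map_zero, zero_mul, sub_zero]; exact zero_mem _
    | monomial a i j =>
      rw [map_smul, smul_mul_assoc, ← smul_sub]
      refine Submodule.smul_mem _ _ ?_
      rcases j with _ | j
      · have h0 : h.divY₂ (y₁ ^ i * y₂ ^ 0) = 0 := by rw [pow_zero, mul_one, h.divY₂_pow]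
        rw [h0, zero_mul, sub_zero]
        exact monomial_mem_y₂Filtration (by omega)
      · rw [h.divY₂_succ, pow_succ, ← mul_assoc, sub_self]
        exact zero_mem _
  have hx1 := h1 x
  rw [hx, zero_mul, sub_zero] at hx1
  clear hx
  induction hx1 using Submodule.span_induction with
  | mem x hx =>
    obtain ⟨i, j, hj, rfl⟩ := hx
    obtain rfl : j = 0 := by omega
    rw [pow_zero, mul_one, ← pow_succ, h.divY₂_pow, h.divY₁_pow_succ]
    exact ⟨rfl, rfl⟩
  | zero => simp
  | add x y _ _ hx hy =>
    rw [add_mul, map_add, map_add, hx.1, hx.2, hy.1, hy.2, add_zero]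
    exact ⟨rfl, rfl⟩
  | smul a x _ hx =>
    rw [smul_mul_assoc, map_smul, map_smul, hx.1, hx.2, smul_zero]
    exact ⟨rfl, rfl⟩

/-- Rewriting `y₂ y₁ = p y₁ y₂ + q y₁²` never raises the degree in `y₂`. -/
theorem mul_y₁_mem_y₂Filtration
    (h : IsTrimmedRightDoubleOreExtension A p q y₁ y₂ σ)
    {n : ℕ} {x : B} (hx : x ∈ y₂Filtration A y₁ y₂ n) :
    x * y₁ ∈ y₂Filtration A y₁ y₂ n := by
  have key : ∀ j i, y₁ ^ i * y₂ ^ j * y₁ ∈ y₂Filtration A y₁ y₂ (j + 1) := by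
    intro j
    induction j using Nat.strong_induction_on with
    | _ j ih =>
      intro i
      rcases j with _ | j
      · rw [pow_zero, mul_one, ← pow_succ, ← mul_one (y₁ ^ (i + 1)), ← pow_zero y₂]
        exact monomial_mem_y₂Filtration (by omega)
      · have e : y₁ ^ i * y₂ ^ (j + 1) * y₁ = p • (y₁ ^ i * y₂ ^ j * y₁ * y₂) +
            q • (y₁ ^ i * y₂ ^ j * y₁ * y₁) := by
          rw [pow_succ, ← mul_assoc, mul_assoc _ y₂ y₁, h.y₂_mul_y₁, mul_add, mul_smul_comm,
            mul_smul_comm, pow_two, ← mul_assoc, ← mul_assoc]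
        have h1 := ih j (by omega) i
        rw [e]
        refine add_mem (Submodule.smul_of_tower_mem _ _ ?_) (Submodule.smul_of_tower_mem _ _ ?_)
        · refine map_mem_y₂Filtration (LinearMap.mulRight A y₂) (fun i l hl => ?_) h1
          change y₁ ^ i * y₂ ^ l * y₂ ∈ _
          rw [mul_assoc, ← pow_succ]
          exact monomial_mem_y₂Filtration (by omega)
        · exact map_mem_y₂Filtration (LinearMap.mulRight A y₁) (fun i l hl =>
            y₂Filtration_mono (by omega) (ih l (by omega) i)) h1
  exact map_mem_y₂Filtration (LinearMap.mulRight A y₁)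
    (fun i j hj => y₂Filtration_mono (by omega) (key j i)) hx

theorem divY₂_mem_y₂Filtration {n : ℕ} {x : B} (hx : x ∈ y₂Filtration A y₁ y₂ (n + 1)) :
    h.divY₂ x ∈ y₂Filtration A y₁ y₂ n := by
  refine map_mem_y₂Filtration h.divY₂ (fun i j hj => ?_) hx
  rcases j with _ | j
  · rw [pow_zero, mul_one, h.divY₂_pow]; exact zero_mem _
  · rw [h.divY₂_succ]; exact monomial_mem_y₂Filtration (by omega)

theorem exists_mem_y₂Filtration
    (h : IsTrimmedRightDoubleOreExtension A p q y₁ y₂ σ)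
    (x : B) : ∃ n, x ∈ y₂Filtration A y₁ y₂ n := by
  induction x using h.induction_on with
  | add x y hx hy =>
    obtain ⟨m, hm⟩ := hx
    obtain ⟨n, hn⟩ := hy
    exact ⟨max m n, add_mem (y₂Filtration_mono (le_max_left _ _) hm)
      (y₂Filtration_mono (le_max_right _ _) hn)⟩
  | zero => exact ⟨0, zero_mem _⟩
  | monomial a i j =>
    exact ⟨j + 1, Submodule.smul_mem _ _ (monomial_mem_y₂Filtration (by omega))⟩

/-- The locally nilpotent operator `x ↦ q (x y₁) / y₂`. -/
noncomputable def nilOp : Module.End A B := q • (h.divY₂ ∘ₗ LinearMap.mulRight A y₁)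

theorem nilOp_apply (x : B) : h.nilOp x = q • h.divY₂ (x * y₁) := rfl

/-- Right multiplication by `y₁` preserves the `y₂`-filtration and division by `y₂` lowers it by
one. -/
theorem exists_nilOp_pow_eq_zero (x : B) : ∃ n, (h.nilOp ^ n) x = 0 := by
  obtain ⟨n, hn⟩ := h.exists_mem_y₂Filtration x
  refine ⟨n, ?_⟩
  induction n generalizing x with
  | zero =>
    have : y₂Filtration A y₁ y₂ 0 = ⊥ := by simp [y₂Filtration]
    rw [this, Submodule.mem_bot] at hn
    rw [hn, map_zero]
  | succ n ih =>
    rw [pow_succ, Module.End.mul_apply]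
    exact ih _ (Submodule.smul_of_tower_mem _ _
      (h.divY₂_mem_y₂Filtration (h.mul_y₁_mem_y₂Filtration hn)))

theorem eq_zero_of_nilOp_eq {x : B} (hx : h.nilOp x = x) : x = 0 := by
  obtain ⟨n, hn⟩ := h.exists_nilOp_pow_eq_zero x
  rw [← hn]
  clear hn
  induction n with
  | zero => rfl
  | succ n ih => rw [pow_succ, Module.End.mul_apply, hx]; exact ih

/-- The inverse of `1 - nilOp` is the geometric series, finite on each element. The clause on `W`
records that it stays in every stable subspace; it is later applied to homogeneous components. -/
theorem exists_sub_nilOp_eq (z : B) : ∃ r, r - h.nilOp r = z ∧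
    ∀ W : Submodule k B, (∀ x ∈ W, h.nilOp x ∈ W) → z ∈ W → r ∈ W := by
  obtain ⟨n, hn⟩ := h.exists_nilOp_pow_eq_zero z
  refine ⟨(∑ i ∈ Finset.range n, h.nilOp ^ i) z, ?_, fun W hW hz => ?_⟩
  · have := LinearMap.congr_fun (mul_neg_geom_sum h.nilOp n) z
    rw [Module.End.mul_apply, LinearMap.sub_apply, LinearMap.sub_apply, hn, sub_zero] at this
    exact this
  · rw [LinearMap.sum_apply]
    refine sum_mem fun i hi => ?_
    clear hi
    induction i with
    | zero => exact hz
    | succ i ih => rw [pow_succ', Module.End.mul_apply]; exact hW _ ih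

theorem divY₂_mul_sub (r : B) : h.divY₂ (r * (y₂ - q • y₁)) = r - h.nilOp r := by
  rw [mul_sub, map_sub, h.divY₂_mul_y₂, mul_smul_comm, LinearMap.map_smul_of_tower, nilOp_apply]

theorem eq_zero_of_mul_sub_eq_zero
    (h : IsTrimmedRightDoubleOreExtension A p q y₁ y₂ σ)
    {r : B} (hr : r * (y₂ - q • y₁) = 0) : r = 0 := by
  have := h.divY₂_mul_sub r
  rw [hr, map_zero, eq_comm, sub_eq_zero] at this
  exact h.eq_zero_of_nilOp_eq this.symm

theorem mul_sub_mul_y₁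
    (h : IsTrimmedRightDoubleOreExtension A p q y₁ y₂ σ)
    (r : B) : r * (y₂ - q • y₁) * y₁ = p • (r * y₁) * y₂ := by
  rw [mul_assoc, sub_mul, h.y₂_mul_y₁, smul_mul_assoc, ← pow_two, add_sub_cancel_right,
    mul_smul_comm, ← mul_assoc, smul_mul_assoc]

/-- Exactness at `B(-1)²`. The element `r` is chosen so that `f = c - r (y₂ - q y₁)` involves only
powers of `y₁`. The relation then reads `f y₁ + (p r y₁ + d) y₂ = 0`; the first term has no `y₂` and
the second is divisible by it, so `divY₂` and `divY₁` show that both brackets vanish. -/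
theorem exists_of_add_eq_zero
    (h : IsTrimmedRightDoubleOreExtension A p q y₁ y₂ σ)
    {c d : B} (hcd : c * y₁ + d * y₂ = 0) :
    ∃ r, r * (y₂ - q • y₁) = c ∧ -(p • (r * y₁)) = d := by
  obtain ⟨r, hr, -⟩ := h.exists_sub_nilOp_eq (h.divY₂ c)
  set f := c - r * (y₂ - q • y₁) with hf
  have hf0 : h.divY₂ f = 0 := by rw [hf, map_sub, h.divY₂_mul_sub, hr, sub_self]
  obtain ⟨h2, h1⟩ := h.divY₂_mul_y₁_of_divY₂_eq_zero hf0
  have e : f * y₁ + (p • (r * y₁) + d) * y₂ = 0 := by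
    rw [hf, sub_mul, h.mul_sub_mul_y₁, add_mul, ← hcd]
    abel
  have hd : p • (r * y₁) + d = 0 := by
    have := congrArg h.divY₂ e
    rwa [map_add, h2, h.divY₂_mul_y₂, zero_add, map_zero] at this
  rw [hd, zero_mul, add_zero] at e
  rw [e, map_zero] at h1
  exact ⟨r, (sub_eq_zero.1 h1.symm).symm, neg_eq_of_add_eq_zero_right hd⟩

end Operators

section Degrees

variable {𝒜 : ℕ → Submodule k A}
  (h : IsTrimmedRightDoubleOreExtension A p q y₁ y₂ σ)

theorem divY₂_mem [SetLike.GradedMonoid 𝒜] {n : ℕ} {x : B}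
    (hx : x ∈ doubleOreGrading A 𝒜 y₁ y₂ n) :
    h.divY₂ x ∈ shiftDeg (doubleOreGrading A 𝒜 y₁ y₂) 1 n := by
  refine map_mem_shiftDeg h.divY₂ (fun i j => ?_) hx
  rcases j with _ | j
  · rw [pow_zero, mul_one, h.divY₂_pow]; exact zero_mem _
  · rw [h.divY₂_succ, ← add_assoc, add_comm _ 1, mem_shiftDeg_add]
    simpa using coe_mul_mem_doubleOreGrading (y₁ := y₁) (y₂ := y₂) (i := i) (j := j)
      (Nat.add_assoc 0 i j |>.trans (Nat.zero_add _)) (SetLike.GradedOne.one_mem (A := 𝒜))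

theorem divY₁_mem [SetLike.GradedMonoid 𝒜] {n : ℕ} {x : B}
    (hx : x ∈ doubleOreGrading A 𝒜 y₁ y₂ n) :
    h.divY₁ x ∈ shiftDeg (doubleOreGrading A 𝒜 y₁ y₂) 1 n := by
  refine map_mem_shiftDeg h.divY₁ (fun i j => ?_) hx
  rcases j with _ | j
  · rcases i with _ | i
    · rw [pow_zero, pow_zero, mul_one, h.divY₁_one]; exact zero_mem _
    · rw [pow_zero, mul_one, h.divY₁_pow_succ, add_zero, add_comm _ 1, mem_shiftDeg_add]
      simpa using coe_mul_mem_doubleOreGrading (y₁ := y₁) (y₂ := y₂) (i := i) (j := 0)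
        (by omega) (SetLike.GradedOne.one_mem (A := 𝒜))
  · rw [h.divY₁_mul_pow_succ]; exact zero_mem _

end Degrees

end IsTrimmedRightDoubleOreExtension

/-! ### Degree bookkeeping for shifts. -/

section Shift

variable {k B : Type*} [Field k] [Ring B] [Algebra k B] {ℬ : ℕ → Submodule k B}

theorem map_mem_shiftDeg_succ {f : B → B} (hf0 : f 0 = 0)
    (hf : ∀ n, ∀ x ∈ ℬ n, f x ∈ shiftDeg ℬ 1 n) {s m : ℕ} {x : B} (hx : x ∈ shiftDeg ℬ s m) :
    f x ∈ shiftDeg ℬ (s + 1) m := by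
  rcases le_or_gt s m with h | h
  · obtain ⟨m, rfl⟩ := Nat.exists_eq_add_of_le h
    have := hf _ _ (mem_shiftDeg_add.1 hx)
    rcases m with _ | m
    · rw [shiftDeg_of_lt (by omega), Submodule.mem_bot] at this
      rw [this]
      exact zero_mem _
    · rw [add_comm m, mem_shiftDeg_add] at this
      rwa [(by omega : s + (m + 1) = s + 1 + m), mem_shiftDeg_add]
  · rw [shiftDeg_of_lt h, Submodule.mem_bot] at hx
    rw [hx, hf0]
    exact zero_mem _

theorem mul_mem_shiftDeg_of_mem_one [SetLike.GradedMonoid ℬ] {s m : ℕ} {x y : B} (hy : y ∈ ℬ 1)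
    (hx : x ∈ shiftDeg ℬ (s + 1) m) : x * y ∈ shiftDeg ℬ s m := by
  rcases le_or_gt (s + 1) m with h | h
  · obtain ⟨m, rfl⟩ := Nat.exists_eq_add_of_le h
    rw [add_assoc s 1 m, mem_shiftDeg_add, add_comm]
    exact SetLike.mul_mem_graded (mem_shiftDeg_add.1 hx) hy
  · rw [shiftDeg_of_lt h, Submodule.mem_bot] at hx
    rw [hx, zero_mul]
    exact zero_mem _

end Shift

namespace IsTrimmedRightDoubleOreExtension

variable {k B : Type*} [Field k] [Ring B] [Algebra k B] {A : Subalgebra k B} {p q : k} {y₁ y₂ : B}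
  {σ : A → Matrix (Fin 2) (Fin 2) A} {𝒜 : ℕ → Submodule k A}
  (h : IsTrimmedRightDoubleOreExtension A p q y₁ y₂ σ)

theorem retraction_mem (𝒜 : ℕ → Submodule k A) [SetLike.GradedMonoid 𝒜] (n : ℕ) (x : B)
    (hx : x ∈ doubleOreGrading A 𝒜 y₁ y₂ n) : h.retraction x ∈ 𝒜 n := by
  have := h.mem_doubleOreGrading_iff.1 hx (0, 0)
  change h.basis.repr x (0, 0) ∈ 𝒜 n
  simpa [shiftDeg] using this

/-- The element `r` is recovered from the product by `divY₂` followed by the geometric series in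
`nilOp`; the former lowers the degree by one and the latter preserves it. -/
theorem mul_sub_mem_shiftDeg_iff [SetLike.GradedMonoid 𝒜]
    (h : IsTrimmedRightDoubleOreExtension A p q y₁ y₂ σ)
    [SetLike.GradedMonoid (doubleOreGrading A 𝒜 y₁ y₂)] {s m : ℕ} {r : B} :
    r * (y₂ - q • y₁) ∈ shiftDeg (doubleOreGrading A 𝒜 y₁ y₂) s m ↔
      r ∈ shiftDeg (doubleOreGrading A 𝒜 y₁ y₂) (s + 1) m := by
  constructor
  · intro hr
    have h1 := map_mem_shiftDeg_succ (map_zero _) (fun n x hx => h.divY₂_mem hx) hr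
    rw [h.divY₂_mul_sub] at h1
    obtain ⟨r', hr', hW⟩ := h.exists_sub_nilOp_eq (r - h.nilOp r)
    obtain rfl : r' = r := by
      rw [← sub_eq_zero]
      refine h.eq_zero_of_nilOp_eq ?_
      rw [map_sub]
      exact (sub_eq_sub_iff_sub_eq_sub.1 hr').symm
    refine hW _ (fun x hx => ?_) h1
    rw [nilOp_apply]
    exact Submodule.smul_mem _ _ (map_mem_shiftDeg_succ (map_zero _)
      (fun n x hx => h.divY₂_mem hx) (mul_mem_shiftDeg_of_mem_one y₁_mem_doubleOreGrading hx))
  · intro hr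
    exact mul_mem_shiftDeg_of_mem_one (sub_mem y₂_mem_doubleOreGrading
      (Submodule.smul_mem _ _ y₁_mem_doubleOreGrading)) hr

end IsTrimmedRightDoubleOreExtension

/-! ### Restriction of covers along a split graded ring homomorphism. -/

section Restriction

variable {k : Type*} {A B : Type u} [Field k] [Ring A] [Algebra k A] [Ring B] [Algebra k B]
  {𝒜 : ℕ → Submodule k A} {ℬ : ℕ → Submodule k B}

/-- Restriction of scalars along a graded ring homomorphism. -/
def resGMod (χ : B →+* A) (hχ : ∀ n, ∀ x ∈ ℬ n, χ x ∈ 𝒜 n) (M : GMod 𝒜) : GMod ℬ where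
  carrier := M.carrier
  module := Module.compHom M.carrier χ
  deg := M.deg
  smul_mem hb hx := M.smul_mem (hχ _ _ hb) hx

/-- The graded free module with basis `ι` in degree `n`. -/
noncomputable def freeGMod (𝒜 : ℕ → Submodule k A) [SetLike.GradedMonoid 𝒜] (n : ℕ) (ι : Type u) :
    GMod 𝒜 where
  carrier := ι →₀ A
  deg := freeDeg 𝒜 fun _ => n
  smul_mem ha hx := smul_mem_freeDeg ha hx

variable (χ : B →+* A) (hχ : ∀ n, ∀ x ∈ ℬ n, χ x ∈ 𝒜 n)

/-- The map of free modules induced by a graded ring homomorphism. -/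
noncomputable def freeRes [SetLike.GradedMonoid 𝒜] (n : ℕ) (ι : Type u) :
    (ι →₀ B) →ₗ[B] (resGMod χ hχ (freeGMod 𝒜 n ι)).carrier :=
  { toFun := fun x => (x.mapRange χ (map_zero χ) : ι →₀ A)
    map_add' := fun x y => Finsupp.mapRange_add (map_add χ) x y
    map_smul' := fun b x => Finsupp.ext fun i => map_mul χ b (x i) }

variable {χ}

theorem mapRange_mem_freeDeg (hχ : ∀ n, ∀ x ∈ ℬ n, χ x ∈ 𝒜 n) {n m : ℕ} {ι : Type u} {x : ι →₀ B}
    (hx : x ∈ freeDeg ℬ (fun _ : ι => n) m) :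
    (x.mapRange χ (map_zero χ) : ι →₀ A) ∈ freeDeg 𝒜 (fun _ : ι => n) m := by
  intro i
  have hi := hx i
  rw [Finsupp.mapRange_apply]
  unfold shiftDeg at hi ⊢
  split_ifs at hi ⊢ with h
  · exact hχ _ _ hi
  · rw [Submodule.mem_bot] at hi
    rw [hi, map_zero]
    exact zero_mem _

variable (χ)

/-- The restriction of an `A`-linear map along `χ`, precomposed with the map of free modules. -/
noncomputable def resCover {ι : Type u} {M : GMod 𝒜}
    (π : (ι →₀ A) →ₗ[A] M.carrier) : (ι →₀ B) →ₗ[B] (resGMod χ hχ M).carrier :=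
  { toFun := fun x => π (x.mapRange χ (map_zero χ))
    map_add' := fun x y => by rw [Finsupp.mapRange_add (map_add χ), map_add]; rfl
    map_smul' := fun b x => by
      have e : (b • x).mapRange χ (map_zero χ) = χ b • x.mapRange χ (map_zero χ) :=
        Finsupp.ext fun i => map_mul χ b (x i)
      rw [e, map_smul]; rfl }

/-- The restriction of a module that has a linear cover has a cover whose kernel is an extension of
the restricted kernel by the kernel of the map of free modules. -/
theorem hasLinearCover_resGMod [SetLike.GradedMonoid 𝒜] [SetLike.GradedMonoid ℬ]
    {𝒞 : ℕ → GMod ℬ → Prop} {𝒟 : ℕ → GMod 𝒜 → Prop} (s : A →+* B) (hs : ∀ a, χ (s a) = a)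
    (hsd : ∀ n, ∀ a ∈ 𝒜 n, s a ∈ ℬ n)
    (hext : ∀ n M' M M'', IsExtension M' M M'' → 𝒞 n M' → 𝒞 n M'' → 𝒞 n M)
    (hres : ∀ n M, 𝒟 n M → 𝒞 n (resGMod χ hχ M))
    (haug : ∀ n ι, 𝒞 (n + 1) (kerGMod n (freeRes χ hχ n ι)))
    {n : ℕ} {M : GMod 𝒜} (hM : HasLinearCover 𝒟 n M) : HasLinearCover 𝒞 n (resGMod χ hχ M) := by
  obtain ⟨ι, π, hπ, hsurj, hd, hker⟩ := hM
  -- The coordinatewise lift along `s` need not be `B`-linear; it only supplies homogeneous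
  -- preimages of elements.
  have hlift : ∀ y : ι →₀ A, (y.mapRange s (map_zero s)).mapRange χ (map_zero χ) = y := fun y =>
    Finsupp.ext fun i => hs (y i)
  refine ⟨ι, resCover χ hχ π, ?_, ?_, ?_,
    hext _ _ _ (resGMod χ hχ (kerGMod n π)) ?_ (haug n ι) (hres _ _ hker)⟩
  · intro i
    change π ((Finsupp.single i (1 : B)).mapRange χ (map_zero χ)) ∈ M.deg n
    rw [Finsupp.mapRange_single, map_one]
    exact hπ i
  · intro x
    obtain ⟨y, rfl⟩ := hsurj x
    exact ⟨y.mapRange s (map_zero s), congrArg π (hlift y)⟩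
  · intro m x hx
    obtain ⟨y, hy, rfl⟩ := hd m x hx
    exact ⟨y.mapRange s (map_zero s), mapRange_mem_freeDeg hsd hy, congrArg π (hlift y)⟩
  · let f : LinearMap.ker (freeRes χ hχ n ι) →ₗ[B] LinearMap.ker (resCover χ hχ π) :=
      Submodule.inclusion fun x hx => by
        change π (freeRes χ hχ n ι x) = 0
        rw [LinearMap.mem_ker.1 hx]
        exact map_zero π
    let g : (kerGMod (𝒜 := ℬ) n (resCover χ hχ π)).carrier →ₗ[B]
        (resGMod χ hχ (kerGMod n π)).carrier :=
      { toFun := fun x => ⟨(Subtype.val x : ι →₀ B).mapRange χ (map_zero χ), x.2⟩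
        map_add' := fun x y => Subtype.ext (Finsupp.ext fun i => map_add χ _ _)
        map_smul' := fun b x => Subtype.ext (Finsupp.ext fun i => map_mul χ b _) }
    refine ⟨f, g, Submodule.inclusion_injective _, ?_, fun m x => Iff.rfl, ?_, ?_, ?_⟩
    · intro (x : LinearMap.ker (resCover χ hχ π))
      constructor
      · intro hx
        exact ⟨⟨x, congrArg Subtype.val hx⟩, rfl⟩
      · rintro ⟨(y : LinearMap.ker (freeRes χ hχ n ι)), rfl⟩
        exact Subtype.ext y.2
    · rintro ⟨y, hy⟩
      refine ⟨⟨y.mapRange s (map_zero s), ?_⟩, Subtype.ext (hlift y)⟩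
      exact (congrArg π (hlift y)).trans hy
    · intro m x hx
      exact mapRange_mem_freeDeg hχ hx
    · rintro m ⟨y, hy⟩ hyd
      refine ⟨⟨y.mapRange s (map_zero s), ?_⟩, mapRange_mem_freeDeg hsd hyd, Subtype.ext (hlift y)⟩
      exact (congrArg π (hlift y)).trans hy

end Restriction

/-! ### The extension-closed family over `B` and its resolution. -/

namespace IsTrimmedRightDoubleOreExtension

variable {k : Type*} {B : Type u} [Field k] [Ring B] [Algebra k B] {A : Subalgebra k B} {p q : k}
  {y₁ y₂ : B} {σ : A → Matrix (Fin 2) (Fin 2) A} {𝒜 : ℕ → Submodule k A}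

/-- Coordinatewise right multiplication. -/
noncomputable def mulRightFree (ι : Type u) (y : B) : (ι →₀ B) →ₗ[B] (ι →₀ B) :=
  Finsupp.mapRange.linearMap (LinearMap.mulRight B y)

theorem mulRightFree_apply {ι : Type u} (y : B) (x : ι →₀ B) (i : ι) :
    mulRightFree ι y x i = x i * y := by
  simp [mulRightFree]

theorem mulRightFree_mem {ℬ : ℕ → Submodule k B} [SetLike.GradedMonoid ℬ] {ι : Type u} {y : B}
    (hy : y ∈ ℬ 1) {n m : ℕ} {x : ι →₀ B} (hx : x ∈ freeDeg ℬ (fun _ : ι => n + 1) m) :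
    mulRightFree ι y x ∈ freeDeg ℬ (fun _ : ι => n) m := fun i => by
  rw [mulRightFree_apply]
  exact mul_mem_shiftDeg_of_mem_one hy (hx i)

/-- This is `0 → B(-2) → B(-1)² → B → A → 0` taken coordinatewise: the kernel of `B^ι → A^ι` is
covered by two copies of `B^ι` generated in degree `n + 1`, and the kernel of that cover is free in
degree `n + 2`. -/
theorem hasLinearCover_kerGMod_freeRes [SetLike.GradedMonoid 𝒜]
    [SetLike.GradedMonoid (doubleOreGrading A 𝒜 y₁ y₂)]
    (h : IsTrimmedRightDoubleOreExtension A p q y₁ y₂ σ)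
    {𝒞 : ℕ → GMod (doubleOreGrading A 𝒜 y₁ y₂) → Prop}
    (hfree : ∀ n M, IsFreeGMod n M → 𝒞 n M) (n : ℕ) (ι : Type u) :
    HasLinearCover 𝒞 (n + 1)
      (kerGMod n (freeRes h.retraction (h.retraction_mem 𝒜) n ι)) := by
  set c := freeRes (𝒜 := 𝒜) (ℬ := doubleOreGrading A 𝒜 y₁ y₂) h.retraction
    (h.retraction_mem 𝒜) n ι
  have hc : ∀ x : ι →₀ B, c x = 0 ↔ ∀ i, h.retraction (x i) = 0 := fun x =>
    ⟨fun hx i => DFunLike.congr_fun (F := ι →₀ A) hx i, fun hx => Finsupp.ext hx⟩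
  let S := Finsupp.sumFinsuppLEquivProdFinsupp (α := ι) (β := ι) (M := B) B
  let π' : (ι ⊕ ι →₀ B) →ₗ[B] (ι →₀ B) :=
    (mulRightFree ι y₁).coprod (mulRightFree ι y₂) ∘ₗ S.toLinearMap
  have hπ' : ∀ u v i, π' (S.symm (u, v)) i = u i * y₁ + v i * y₂ := by
    intro u v i
    have e : π' (S.symm (u, v)) = mulRightFree ι y₁ u + mulRightFree ι y₂ v := by simp [π']
    rw [e, Finsupp.add_apply, mulRightFree_apply, mulRightFree_apply]
  have hπ'c : ∀ x, π' x ∈ LinearMap.ker c := by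
    intro x
    rw [LinearMap.mem_ker, hc]
    intro i
    rw [← S.symm_apply_apply x]
    change h.retraction (π' (S.symm ((S x).1, (S x).2)) i) = 0
    rw [hπ', map_add, map_mul, map_mul, retraction_y₁, retraction_y₂, mul_zero, mul_zero, add_zero]
  let π : (ι ⊕ ι →₀ B) →ₗ[B] LinearMap.ker c := π'.codRestrict _ hπ'c
  have hdiv : ∀ x ∈ LinearMap.ker c,
      π' (S.symm (x.mapRange h.divY₁ (map_zero _), x.mapRange h.divY₂ (map_zero _))) = x := by
    intro x hx
    ext i
    rw [hπ', Finsupp.mapRange_apply, Finsupp.mapRange_apply]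
    exact h.eq_add_of_retraction_eq_zero ((hc x).1 hx i)
  refine ⟨ι ⊕ ι, π, ?_, ?_, ?_, hfree _ _ ?_⟩
  · intro i
    change π' (Finsupp.single i 1) ∈ freeDeg (doubleOreGrading A 𝒜 y₁ y₂) (fun _ : ι => n) (n + 1)
    rcases i with i | i
    · have e : Finsupp.single (Sum.inl i) 1 = S.symm (Finsupp.single i (1 : B), 0) := by simp [S]
      have e2 : π' (S.symm (Finsupp.single i (1 : B), 0)) =
          mulRightFree ι y₁ (Finsupp.single i 1) := by simp [π']
      rw [e, e2]
      exact mulRightFree_mem y₁_mem_doubleOreGrading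
        (single_one_mem_freeDeg (s := fun _ => n + 1) i)
    · have e : Finsupp.single (Sum.inr i) 1 = S.symm (0, Finsupp.single i (1 : B)) := by simp [S]
      have e2 : π' (S.symm (0, Finsupp.single i (1 : B))) =
          mulRightFree ι y₂ (Finsupp.single i 1) := by simp [π']
      rw [e, e2]
      exact mulRightFree_mem y₂_mem_doubleOreGrading
        (single_one_mem_freeDeg (s := fun _ => n + 1) i)
  · rintro ⟨x, hx⟩
    exact ⟨_, Subtype.ext (hdiv x hx)⟩
  · rintro m ⟨x, hx⟩ hxd
    refine ⟨_, mem_freeDeg_sumElim.2 ⟨fun i => ?_, fun i => ?_⟩, Subtype.ext (hdiv x hx)⟩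
    · rw [Finsupp.mapRange_apply]
      exact map_mem_shiftDeg_succ (map_zero _) (fun n x hx => h.divY₁_mem hx) (hxd i)
    · rw [Finsupp.mapRange_apply]
      exact map_mem_shiftDeg_succ (map_zero _) (fun n x hx => h.divY₂_mem hx) (hxd i)
  · let e' : (ι →₀ B) →ₗ[B] (ι ⊕ ι →₀ B) := S.symm.toLinearMap ∘ₗ
      (mulRightFree ι (y₂ - q • y₁)).prod (mulRightFree ι (-(p • y₁)))
    have he' : ∀ r, e' r = S.symm (mulRightFree ι (y₂ - q • y₁) r, mulRightFree ι (-(p • y₁)) r) :=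
      fun r => rfl
    let e : (ι →₀ B) →ₗ[B] LinearMap.ker π := e'.codRestrict _ (fun r => by
      refine Subtype.ext (Finsupp.ext fun i => ?_)
      change π' (e' r) i = 0
      rw [he', hπ', mulRightFree_apply, mulRightFree_apply, h.mul_sub_mul_y₁, mul_neg, neg_mul,
        mul_smul_comm, add_neg_cancel])
    refine ⟨ι, e, ⟨?_, ?_⟩, ?_⟩
    · refine (injective_iff_map_eq_zero e).2 fun r hr => ?_
      have hr' : e' r = 0 := congrArg Subtype.val hr
      rw [he', LinearEquiv.map_eq_zero_iff, Prod.mk_eq_zero] at hr'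
      ext i
      refine h.eq_zero_of_mul_sub_eq_zero ?_
      rw [← mulRightFree_apply, hr'.1, Finsupp.zero_apply]
    · rintro ⟨x, hx⟩
      have hx' : π' x = 0 := congrArg Subtype.val hx
      obtain ⟨⟨u, v⟩, rfl⟩ := S.symm.surjective x
      have huv : ∀ i, u i * y₁ + v i * y₂ = 0 := fun i => by
        rw [← hπ', hx', Finsupp.zero_apply]
      choose r hr₁ hr₂ using fun i => h.exists_of_add_eq_zero (huv i)
      -- The chosen `r` has finite support because right multiplication by `y₂ - q y₁` is injective,
      -- so `u i = 0` forces `r i = 0`.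
      refine ⟨Finsupp.onFinset u.support r fun i hi => ?_, Subtype.ext ?_⟩
      · rw [Finsupp.mem_support_iff]
        intro hu
        exact hi (h.eq_zero_of_mul_sub_eq_zero ((hr₁ i).trans hu))
      · change e' _ = _
        rw [he']
        refine congrArg S.symm (Prod.ext (Finsupp.ext fun i => ?_) (Finsupp.ext fun i => ?_))
        · rw [mulRightFree_apply, Finsupp.onFinset_apply, hr₁]
        · rw [mulRightFree_apply, Finsupp.onFinset_apply, mul_neg, mul_smul_comm, hr₂]
    · intro m r
      change e' r ∈ freeDeg (doubleOreGrading A 𝒜 y₁ y₂) (fun _ : ι ⊕ ι => n + 1) m ↔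
        r ∈ freeDeg (doubleOreGrading A 𝒜 y₁ y₂) (fun _ : ι => n + 1 + 1) m
      rw [he', mem_freeDeg_sumElim]
      constructor
      -- The first coordinate alone determines the degree; the second carries the factor `p`, which
      -- may be zero.
      · rintro ⟨h1, -⟩ i
        have := h1 i
        rw [mulRightFree_apply] at this
        exact h.mul_sub_mem_shiftDeg_iff.1 this
      · intro hr
        refine ⟨fun i => ?_, mulRightFree_mem
          (neg_mem (Submodule.smul_mem _ _ y₁_mem_doubleOreGrading)) hr⟩
        rw [mulRightFree_apply]
        exact h.mul_sub_mem_shiftDeg_iff.2 (hr i)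

/-- The closure under extensions of the restrictions of modules in `𝒟`, the first syzygies of
restrictions of free modules, and free modules. -/
inductive ExtClosure [SetLike.GradedMonoid 𝒜] [SetLike.GradedMonoid (doubleOreGrading A 𝒜 y₁ y₂)]
    (h : IsTrimmedRightDoubleOreExtension A p q y₁ y₂ σ) (𝒟 : ℕ → GMod 𝒜 → Prop) :
    ℕ → GMod (doubleOreGrading A 𝒜 y₁ y₂) → Prop
  | ext (n M' M M'') : IsExtension M' M M'' → ExtClosure h 𝒟 n M' → ExtClosure h 𝒟 n M'' →
      ExtClosure h 𝒟 n M
  | res (n M) : 𝒟 n M →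
      ExtClosure h 𝒟 n (resGMod h.retraction (h.retraction_mem 𝒜) M)
  | syz (n ι) : ExtClosure h 𝒟 (n + 1)
      (kerGMod n (freeRes h.retraction (h.retraction_mem 𝒜) n ι))
  | free (n M) : IsFreeGMod n M → ExtClosure h 𝒟 n M

theorem ExtClosure.hasLinearCover [SetLike.GradedMonoid 𝒜]
    [SetLike.GradedMonoid (doubleOreGrading A 𝒜 y₁ y₂)]
    (h : IsTrimmedRightDoubleOreExtension A p q y₁ y₂ σ) {𝒟 : ℕ → GMod 𝒜 → Prop}
    (h𝒟 : ∀ n M, 𝒟 n M → HasLinearCover 𝒟 n M) (n : ℕ)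
    (M : GMod (doubleOreGrading A 𝒜 y₁ y₂)) (hM : ExtClosure h 𝒟 n M) :
    HasLinearCover (ExtClosure h 𝒟) n M := by
  induction hM with
  | ext n M' M M'' hex _ _ h' h'' => exact hasLinearCover_of_isExtension .ext hex h' h''
  | res n M hM =>
    exact hasLinearCover_resGMod _ _ A.val.toRingHom h.retraction_coe
      (fun _ _ ha => coe_mem_doubleOreGrading ha) .ext .res .syz (h𝒟 n M hM)
  | syz n ι => exact h.hasLinearCover_kerGMod_freeRes .free n ι
  | free n M hM => exact hM.hasLinearCover .free

theorem retraction_mem_augmentationIdeal_iff [GradedAlgebra 𝒜]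
    [GradedAlgebra (doubleOreGrading A 𝒜 y₁ y₂)]
    (h : IsTrimmedRightDoubleOreExtension A p q y₁ y₂ σ) (x : B) :
    h.retraction x ∈ augmentationIdeal 𝒜 ↔
      x ∈ augmentationIdeal (doubleOreGrading A 𝒜 y₁ y₂) := by
  constructor
  · intro hx
    have hle : ∀ a ∈ augmentationIdeal 𝒜,
        (a : B) ∈ augmentationIdeal (doubleOreGrading A 𝒜 y₁ y₂) := by
      intro a ha
      induction ha using Submodule.span_induction with
      | mem a ha =>
        obtain ⟨n, hn, ha⟩ := ha
        exact Submodule.subset_span ⟨n, hn, coe_mem_doubleOreGrading ha⟩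
      | zero => exact zero_mem _
      | add a b _ _ ha hb => exact add_mem ha hb
      | smul a b _ hb => exact Submodule.smul_mem _ (a : B) hb
    rw [← h.coeffOne_add x]
    refine add_mem (add_mem (hle _ hx) ?_) ?_
    · exact Submodule.smul_mem _ _ (Submodule.subset_span ⟨1, le_rfl, y₁_mem_doubleOreGrading⟩)
    · exact Submodule.smul_mem _ _ (Submodule.subset_span ⟨1, le_rfl, y₂_mem_doubleOreGrading⟩)
  · intro hx
    induction hx using Submodule.span_induction with
    | mem x hx =>
      obtain ⟨n, hn, hx⟩ := hx
      exact Submodule.subset_span ⟨n, hn, h.retraction_mem 𝒜 _ _ hx⟩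
    | zero => rw [map_zero]; exact zero_mem _
    | add x y _ _ hx hy => rw [map_add]; exact add_mem hx hy
    | smul b x _ hx => rw [smul_eq_mul, map_mul]; exact Submodule.smul_mem _ _ hx

/-- The two trivial modules are isomorphic but not equal. Writing the isomorphism as an extension by
the zero module lets `ExtClosure` absorb it without a separate closure under isomorphism. -/
theorem isExtension_trivialGMod [GradedAlgebra 𝒜] [GradedAlgebra (doubleOreGrading A 𝒜 y₁ y₂)]
    (h : IsTrimmedRightDoubleOreExtension A p q y₁ y₂ σ) :
    IsExtension (freeGMod _ 0 PEmpty) (trivialGMod (doubleOreGrading A 𝒜 y₁ y₂))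
      (resGMod h.retraction (h.retraction_mem 𝒜) (trivialGMod 𝒜)) := by
  let R := resGMod (ℬ := doubleOreGrading A 𝒜 y₁ y₂) h.retraction
    (h.retraction_mem 𝒜) (trivialGMod 𝒜)
  let g₀ : B →ₗ[B] R.carrier :=
    { toFun := fun x => (Submodule.Quotient.mk (h.retraction x) : TrivialModule 𝒜)
      map_add' := fun x y => by rw [map_add]; rfl
      map_smul' := fun b x => by rw [smul_eq_mul, map_mul]; rfl }
  have hg₀ : ∀ x, g₀ x = 0 ↔ x ∈ augmentationIdeal (doubleOreGrading A 𝒜 y₁ y₂) := fun x =>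
    (Submodule.Quotient.mk_eq_zero _).trans (h.retraction_mem_augmentationIdeal_iff x)
  let g : TrivialModule (doubleOreGrading A 𝒜 y₁ y₂) →ₗ[B] R.carrier :=
    Submodule.liftQ _ g₀ fun x hx => (hg₀ x).2 hx
  have hg : ∀ x : TrivialModule (doubleOreGrading A 𝒜 y₁ y₂), g x = 0 → x = 0 := by
    intro x hx
    induction x using Submodule.Quotient.induction_on with
    | _ x => exact (Submodule.Quotient.mk_eq_zero _).2 ((hg₀ x).1 hx)
  have hgs : Function.Surjective g := by
    intro (y : TrivialModule 𝒜)
    induction y using Submodule.Quotient.induction_on with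
    | _ a =>
      refine ⟨Submodule.Quotient.mk (a : B), ?_⟩
      change (Submodule.Quotient.mk (h.retraction (a : B)) : TrivialModule 𝒜) = _
      rw [h.retraction_coe]
  have hsub : Subsingleton (freeGMod (doubleOreGrading A 𝒜 y₁ y₂) 0 PEmpty).carrier :=
    inferInstanceAs (Subsingleton (PEmpty →₀ B))
  have hdeg : ∀ m x, x ∈ (trivialGMod (doubleOreGrading A 𝒜 y₁ y₂)).deg m ↔ m = 0 ∨ x = 0 := by
    intro m x
    change x ∈ (if m = 0 then ⊤ else (⊥ : AddSubgroup (TrivialModule _))) ↔ _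
    split_ifs with hm
    · exact iff_of_true trivial (Or.inl hm)
    · simp only [hm, false_or]; rfl
  have hdeg' : ∀ m x, x ∈ R.deg m ↔ m = 0 ∨ x = 0 := by
    intro m x
    change x ∈ (if m = 0 then ⊤ else (⊥ : AddSubgroup (TrivialModule _))) ↔ _
    split_ifs with hm
    · exact iff_of_true trivial (Or.inl hm)
    · simp only [hm, false_or]; rfl
  refine ⟨0, g, Function.injective_of_subsingleton _, ?_, ?_, hgs, ?_, ?_⟩
  · intro x
    refine ⟨fun hx => ⟨0, (hg x hx).symm⟩, ?_⟩
    rintro ⟨y, rfl⟩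
    exact map_zero g
  · intro m x
    rw [Subsingleton.elim x 0]
    exact iff_of_true (by rw [map_zero]; exact zero_mem _) (zero_mem _)
  · intro m x hx
    rw [hdeg] at hx
    rw [hdeg']
    exact hx.imp_right fun hx => by rw [hx]; exact map_zero g
  · intro m y hy
    rw [hdeg'] at hy
    rcases hy with rfl | rfl
    · obtain ⟨x, rfl⟩ := hgs y
      exact ⟨x, (hdeg _ _).2 (Or.inl rfl), rfl⟩
    · exact ⟨0, zero_mem _, map_zero g⟩

theorem nonempty_linearProjectiveResolution [GradedAlgebra 𝒜]
    [GradedAlgebra (doubleOreGrading A 𝒜 y₁ y₂)]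
    (h : IsTrimmedRightDoubleOreExtension A p q y₁ y₂ σ)
    (h0 : 𝒜 0 = LinearMap.range (Algebra.linearMap k A)) (R : LinearProjectiveResolution 𝒜) :
    Nonempty (LinearProjectiveResolution (doubleOreGrading A 𝒜 y₁ y₂)) := by
  refine nonempty_resolution (𝒞 := ExtClosure h R.IsSyzygy)
    (ExtClosure.hasLinearCover h (LinearProjectiveResolution.IsSyzygy.hasLinearCover h0 R)) ?_
  refine .ext _ _ _ _ h.isExtension_trivialGMod (.free _ _ ?_) (.res _ _ R.isSyzygy_trivialGMod)
  exact ⟨PEmpty, LinearMap.id, Function.bijective_id, fun m x => Iff.rfl⟩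

end IsTrimmedRightDoubleOreExtension

/-! ### Quadraticity of `B`. -/

namespace IsTrimmedRightDoubleOreExtension

variable {k B : Type*} [Field k] [Ring B] [Algebra k B] {A : Subalgebra k B} {p q : k} {y₁ y₂ : B}
  {σ : A → Matrix (Fin 2) (Fin 2) A} {𝒜 : ℕ → Submodule k A}

theorem mem_doubleOreGrading_one (h0 : 𝒜 0 = LinearMap.range (Algebra.linearMap k A)) {b : B}
    (hb : b ∈ doubleOreGrading A 𝒜 y₁ y₂ 1) :
    ∃ a ∈ 𝒜 1, ∃ c d : k, b = (a : B) + c • y₁ + d • y₂ := by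
  have hscalar : ∀ a ∈ 𝒜 0, ∃ c : k, ∀ x : B, (a : B) * x = c • x := by
    intro a ha
    rw [h0] at ha
    obtain ⟨c, rfl⟩ := ha
    exact ⟨c, fun x => (Algebra.smul_def c x).symm⟩
  induction hb using Submodule.span_induction with
  | mem b hb =>
    obtain ⟨m, i, j, hm, a, ha, rfl⟩ := hb
    obtain ⟨rfl, rfl, rfl⟩ | ⟨rfl, rfl, rfl⟩ | ⟨rfl, rfl, rfl⟩ :
        (m = 1 ∧ i = 0 ∧ j = 0) ∨ (m = 0 ∧ i = 1 ∧ j = 0) ∨ (m = 0 ∧ i = 0 ∧ j = 1) := by omega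
    · exact ⟨a, ha, 0, 0, by simp⟩
    · obtain ⟨c, hc⟩ := hscalar a ha
      exact ⟨0, zero_mem _, c, 0, by simp [hc]⟩
    · obtain ⟨c, hc⟩ := hscalar a ha
      exact ⟨0, zero_mem _, 0, c, by simp [hc]⟩
  | zero => exact ⟨0, zero_mem _, 0, 0, by simp⟩
  | add x y _ _ hx hy =>
    obtain ⟨a, ha, c, d, rfl⟩ := hx
    obtain ⟨a', ha', c', d', rfl⟩ := hy
    refine ⟨a + a', add_mem ha ha', c + c', d + d', ?_⟩
    rw [Subalgebra.coe_add, add_smul, add_smul]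
    abel
  | smul e x _ hx =>
    obtain ⟨a, ha, c, d, rfl⟩ := hx
    refine ⟨e • a, Submodule.smul_mem _ _ ha, e * c, e * d, ?_⟩
    rw [Subalgebra.coe_smul, smul_add, smul_add, smul_smul, smul_smul]

theorem doubleOreGrading_zero (h0 : 𝒜 0 = LinearMap.range (Algebra.linearMap k A)) :
    doubleOreGrading A 𝒜 y₁ y₂ 0 = LinearMap.range (Algebra.linearMap k B) := by
  apply le_antisymm
  · refine Submodule.span_le.2 ?_
    rintro _ ⟨m, i, j, hm, a, ha, rfl⟩
    obtain ⟨rfl, rfl, rfl⟩ : m = 0 ∧ i = 0 ∧ j = 0 := by omega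
    rw [h0] at ha
    obtain ⟨c, rfl⟩ := ha
    exact ⟨c, by simp⟩
  · rintro _ ⟨c, rfl⟩
    have : algebraMap k A c ∈ 𝒜 0 := h0 ▸ ⟨c, rfl⟩
    exact coe_mem_doubleOreGrading this

theorem finiteDimensional_doubleOreGrading_one
    (h0 : 𝒜 0 = LinearMap.range (Algebra.linearMap k A)) [FiniteDimensional k (𝒜 1)] :
    FiniteDimensional k (doubleOreGrading A 𝒜 y₁ y₂ 1) := by
  have hle : doubleOreGrading A 𝒜 y₁ y₂ 1 ≤
      (𝒜 1).map A.val.toLinearMap ⊔ Submodule.span k {y₁, y₂} := by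
    intro b hb
    obtain ⟨a, ha, c, d, rfl⟩ := mem_doubleOreGrading_one h0 hb
    rw [add_assoc]
    exact Submodule.add_mem_sup ⟨a, ha, rfl⟩ (add_mem
      (Submodule.smul_mem _ _ (Submodule.subset_span (by simp)))
      (Submodule.smul_mem _ _ (Submodule.subset_span (by simp))))
  have : FiniteDimensional k (Submodule.span k {y₁, y₂} : Submodule k B) :=
    FiniteDimensional.span_of_finite k (by simp)
  exact Submodule.finiteDimensional_of_le hle

/-- The inclusion of `A₁` into `B₁`. -/
def degreeOneInclusion (A : Subalgebra k B) (𝒜 : ℕ → Submodule k A) (y₁ y₂ : B) :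
    𝒜 1 →ₗ[k] doubleOreGrading A 𝒜 y₁ y₂ 1 :=
  (A.val.toLinearMap ∘ₗ (𝒜 1).subtype).codRestrict _ fun a => coe_mem_doubleOreGrading a.2

/-- The inclusion of tensor algebras induced by the inclusion of `A₁` into `B₁`. -/
noncomputable def tensorInclusion (A : Subalgebra k B) (𝒜 : ℕ → Submodule k A) (y₁ y₂ : B) :
    TensorAlgebra k (𝒜 1) →ₐ[k] TensorAlgebra k (doubleOreGrading A 𝒜 y₁ y₂ 1) :=
  TensorAlgebra.lift k (TensorAlgebra.ι k ∘ₗ degreeOneInclusion A 𝒜 y₁ y₂)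

theorem tensorInclusion_ι (a : 𝒜 1) : tensorInclusion A 𝒜 y₁ y₂ (TensorAlgebra.ι k a) =
    TensorAlgebra.ι k (degreeOneInclusion A 𝒜 y₁ y₂ a) :=
  TensorAlgebra.lift_ι_apply _ _

theorem tensorToAlgebra_ι {A : Type*} [Ring A] [Algebra k A] (𝒜 : ℕ → Submodule k A) (a : 𝒜 1) :
    tensorToAlgebra 𝒜 (TensorAlgebra.ι k a) = a :=
  TensorAlgebra.lift_ι_apply _ _

theorem tensorToAlgebra_tensorInclusion (t : TensorAlgebra k (𝒜 1)) :
    tensorToAlgebra (doubleOreGrading A 𝒜 y₁ y₂) (tensorInclusion A 𝒜 y₁ y₂ t) =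
      tensorToAlgebra 𝒜 t := by
  have : (tensorToAlgebra (doubleOreGrading A 𝒜 y₁ y₂)).comp (tensorInclusion A 𝒜 y₁ y₂) =
      A.val.comp (tensorToAlgebra 𝒜) := by
    refine TensorAlgebra.hom_ext (LinearMap.ext fun a => ?_)
    change tensorToAlgebra _ (tensorInclusion A 𝒜 y₁ y₂ (TensorAlgebra.ι k a)) =
      (tensorToAlgebra 𝒜 (TensorAlgebra.ι k a) : B)
    rw [tensorInclusion_ι, tensorToAlgebra_ι, tensorToAlgebra_ι]
    rfl
  exact DFunLike.congr_fun this t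

theorem tensorToAlgebra_surjective [SetLike.GradedMonoid 𝒜]
    (h : IsTrimmedRightDoubleOreExtension A p q y₁ y₂ σ)
    (hA : Function.Surjective (tensorToAlgebra 𝒜)) :
    Function.Surjective (tensorToAlgebra (doubleOreGrading A 𝒜 y₁ y₂)) := by
  rw [← AlgHom.range_eq_top, eq_top_iff, ← h.generated, Algebra.adjoin_le_iff]
  rintro b (hb | rfl | rfl)
  · obtain ⟨t, ht⟩ := hA ⟨b, hb⟩
    exact ⟨tensorInclusion A 𝒜 y₁ y₂ t, by
      change tensorToAlgebra _ (tensorInclusion A 𝒜 y₁ y₂ t) = b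
      rw [tensorToAlgebra_tensorInclusion, ht]⟩
  · exact ⟨TensorAlgebra.ι k ⟨b, y₁_mem_doubleOreGrading⟩, tensorToAlgebra_ι _ _⟩
  · exact ⟨TensorAlgebra.ι k ⟨b, y₂_mem_doubleOreGrading⟩, tensorToAlgebra_ι _ _⟩

/-- The quadratic relations of a graded algebra. -/
noncomputable def quadraticRelations {A : Type*} [Ring A] [Algebra k A] (𝒜 : ℕ → Submodule k A) :
    Submodule k (TensorAlgebra k (𝒜 1)) :=
  LinearMap.range (TensorAlgebra.ι k (M := 𝒜 1)) ^ 2 ⊓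
    LinearMap.ker (tensorToAlgebra 𝒜).toLinearMap

theorem ι_mul_ι_mem {M : Type*} [AddCommGroup M] [Module k M] (x y : M) :
    TensorAlgebra.ι k x * TensorAlgebra.ι k y ∈
      LinearMap.range (TensorAlgebra.ι k (M := M)) ^ 2 := by
  rw [pow_two]
  exact Submodule.mul_mem_mul ⟨x, rfl⟩ ⟨y, rfl⟩

section Straightening

variable {Q : Type*} [Ring Q] [Algebra k Q]
  (ψ : TensorAlgebra k (doubleOreGrading A 𝒜 y₁ y₂ 1) →ₐ[k] Q)

/-- Only for `t` in `A₁` is the commutation rule a quadratic relation, with `σ` giving the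
coefficients. For products the letters are moved across one factor at a time, so no multiplicativity
of `σ` enters. -/
theorem exists_mul_eq_of_quadraticRelations [SetLike.GradedMonoid 𝒜]
    (hψ : ∀ t ∈ quadraticRelations (doubleOreGrading A 𝒜 y₁ y₂), ψ t = 0)
    (h : IsTrimmedRightDoubleOreExtension A p q y₁ y₂ σ)
    (hσ : ∀ n, ∀ a ∈ 𝒜 n, ∀ i j, σ a i j ∈ 𝒜 n) (t : TensorAlgebra k (𝒜 1)) :
    let η := ψ.comp (tensorInclusion A 𝒜 y₁ y₂)
    let Y₁ := ψ (TensorAlgebra.ι k ⟨y₁, y₁_mem_doubleOreGrading⟩)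
    let Y₂ := ψ (TensorAlgebra.ι k ⟨y₂, y₂_mem_doubleOreGrading⟩)
    (∃ s s', Y₁ * η t = η s * Y₁ + η s' * Y₂) ∧ (∃ s s', Y₂ * η t = η s * Y₁ + η s' * Y₂) := by
  intro η Y₁ Y₂
  induction t using TensorAlgebra.induction with
  | algebraMap c =>
    refine ⟨⟨algebraMap k _ c, 0, ?_⟩, ⟨0, algebraMap k _ c, ?_⟩⟩
    · rw [map_zero, zero_mul, add_zero, AlgHom.commutes, Algebra.commutes]
    · rw [map_zero, zero_mul, zero_add, AlgHom.commutes, Algebra.commutes]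
  | ι v =>
    have key : ∀ (y : B) (hy : y ∈ doubleOreGrading A 𝒜 y₁ y₂ 1) (a b : 𝒜 1),
        y * (v : A) = (a : A) * y₁ + (b : A) * y₂ →
        ψ (TensorAlgebra.ι k ⟨y, hy⟩) * η (TensorAlgebra.ι k v) =
          η (TensorAlgebra.ι k a) * Y₁ + η (TensorAlgebra.ι k b) * Y₂ := by
      intro y hy a b hab
      rw [← sub_eq_zero]
      simp only [η, Y₁, Y₂, AlgHom.comp_apply, tensorInclusion_ι, ← map_mul, ← map_add, ← map_sub]
      refine hψ _ ⟨sub_mem (ι_mul_ι_mem _ _) (add_mem (ι_mul_ι_mem _ _) (ι_mul_ι_mem _ _)), ?_⟩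
      change tensorToAlgebra _ _ = 0
      simp only [map_sub, map_add, map_mul, tensorToAlgebra_ι]
      exact sub_eq_zero.2 hab
    exact ⟨⟨_, _, key y₁ _ ⟨_, hσ 1 _ v.2 0 0⟩ ⟨_, hσ 1 _ v.2 0 1⟩ (h.y₁_mul_coe v)⟩,
      ⟨_, _, key y₂ _ ⟨_, hσ 1 _ v.2 1 0⟩ ⟨_, hσ 1 _ v.2 1 1⟩ (h.y₂_mul_coe v)⟩⟩
  | mul a b ha hb =>
    obtain ⟨⟨b₁, b₂, hb⟩, ⟨b₁', b₂', hb'⟩⟩ := hb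
    have key : ∀ Y, (∃ s s', Y * η a = η s * Y₁ + η s' * Y₂) →
        ∃ s s', Y * η (a * b) = η s * Y₁ + η s' * Y₂ := by
      rintro Y ⟨a₁, a₂, ha⟩
      refine ⟨a₁ * b₁ + a₂ * b₁', a₁ * b₂ + a₂ * b₂', ?_⟩
      rw [map_mul, ← mul_assoc, ha, add_mul, mul_assoc, hb, mul_assoc, hb']
      simp only [map_add, map_mul, mul_add, add_mul, mul_assoc]
      abel
    exact ⟨key _ ha.1, key _ ha.2⟩
  | add a b ha hb =>
    obtain ⟨⟨a₁, a₂, ha⟩, ⟨a₁', a₂', ha'⟩⟩ := ha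
    obtain ⟨⟨b₁, b₂, hb⟩, ⟨b₁', b₂', hb'⟩⟩ := hb
    refine ⟨⟨a₁ + b₁, a₂ + b₂, ?_⟩, ⟨a₁' + b₁', a₂' + b₂', ?_⟩⟩
    · rw [map_add, mul_add, ha, hb, map_add, map_add, add_mul, add_mul]
      abel
    · rw [map_add, mul_add, ha', hb', map_add, map_add, add_mul, add_mul]
      abel

/-- The linear map sending a family of coefficients `f` to `∑ f i j y₁^i y₂^j`. -/
noncomputable def normalForm {T Q : Type*} [Ring T] [Algebra k T] [Ring Q] [Algebra k Q]
    (η : T →ₐ[k] Q) (Y₁ Y₂ : Q) : (ℕ × ℕ →₀ T) →ₗ[k] Q :=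
  Finsupp.lsum k fun ij => LinearMap.mulRight k (Y₁ ^ ij.1 * Y₂ ^ ij.2) ∘ₗ η.toLinearMap

theorem normalForm_apply {T Q : Type*} [Ring T] [Algebra k T] [Ring Q] [Algebra k Q]
    (η : T →ₐ[k] Q) (Y₁ Y₂ : Q) (f : ℕ × ℕ →₀ T) :
    normalForm η Y₁ Y₂ f = f.sum fun ij t => η t * (Y₁ ^ ij.1 * Y₂ ^ ij.2) := by
  rw [normalForm, Finsupp.coe_lsum]
  rfl

theorem normalForm_single {T Q : Type*} [Ring T] [Algebra k T] [Ring Q] [Algebra k Q]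
    (η : T →ₐ[k] Q) (Y₁ Y₂ : Q) (t : T) (i j : ℕ) :
    normalForm η Y₁ Y₂ (Finsupp.single (i, j) t) = η t * (Y₁ ^ i * Y₂ ^ j) := by
  rw [normalForm_apply, Finsupp.sum_single_index (by simp)]

theorem mem_range_normalForm {T Q : Type*} [Ring T] [Algebra k T] [Ring Q] [Algebra k Q]
    (η : T →ₐ[k] Q) (Y₁ Y₂ : Q) (t : T) (i j : ℕ) :
    η t * (Y₁ ^ i * Y₂ ^ j) ∈ LinearMap.range (normalForm η Y₁ Y₂) :=
  ⟨_, normalForm_single η Y₁ Y₂ t i j⟩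

/-- The hypothesis on `x` covers left multiplication by `Y₁` or `Y₂` (with `s'' = 0`) and by
elements from `A₁` (with `s = s' = 0`). -/
theorem mul_mem_range_normalForm {T Q : Type*} [Ring T] [Algebra k T] [Ring Q] [Algebra k Q]
    (η : T →ₐ[k] Q) {Y₁ Y₂ : Q} (hY : Y₂ * Y₁ = p • (Y₁ * Y₂) + q • Y₁ ^ 2) {x z : Q}
    (hx : ∀ t, ∃ s s' s'', x * η t = η s * Y₁ + η s' * Y₂ + η s'')
    (hz : z ∈ LinearMap.range (normalForm η Y₁ Y₂)) :
    x * z ∈ LinearMap.range (normalForm η Y₁ Y₂) := by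
  obtain ⟨f, rfl⟩ := hz
  rw [normalForm_apply, Finsupp.sum, Finset.mul_sum]
  refine sum_mem fun ij _ => ?_
  obtain ⟨i, j⟩ := ij
  obtain ⟨s, s', s'', hs⟩ := hx (f (i, j))
  obtain ⟨c, hc⟩ := y₂_mul_y₁_pow hY i
  have e : x * (η (f (i, j)) * (Y₁ ^ i * Y₂ ^ j)) = η s * (Y₁ ^ (i + 1) * Y₂ ^ j) +
      (p ^ i • (η s' * (Y₁ ^ i * Y₂ ^ (j + 1))) + c • (η s' * (Y₁ ^ (i + 1) * Y₂ ^ j))) +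
      η s'' * (Y₁ ^ i * Y₂ ^ j) := by
    rw [← mul_assoc, hs, add_mul, add_mul, mul_assoc, ← mul_assoc Y₁, ← pow_succ',
      mul_assoc (η s'), ← mul_assoc Y₂, hc, add_mul, smul_mul_assoc, mul_assoc (Y₁ ^ i),
      ← pow_succ', mul_add, smul_mul_assoc, mul_smul_comm, mul_smul_comm]
  change x * (η (f (i, j)) * (Y₁ ^ i * Y₂ ^ j)) ∈ _
  rw [e]
  exact add_mem (add_mem (mem_range_normalForm ..) (add_mem
    (Submodule.smul_mem _ _ (mem_range_normalForm ..))
    (Submodule.smul_mem _ _ (mem_range_normalForm ..)))) (mem_range_normalForm ..)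

theorem mem_range_normalForm_of_quadraticRelations [SetLike.GradedMonoid 𝒜]
    (h0 : 𝒜 0 = LinearMap.range (Algebra.linearMap k A))
    (hψ : ∀ t ∈ quadraticRelations (doubleOreGrading A 𝒜 y₁ y₂), ψ t = 0)
    (h : IsTrimmedRightDoubleOreExtension A p q y₁ y₂ σ)
    (hσ : ∀ n, ∀ a ∈ 𝒜 n, ∀ i j, σ a i j ∈ 𝒜 n)
    (t : TensorAlgebra k (doubleOreGrading A 𝒜 y₁ y₂ 1)) :
    ψ t ∈ LinearMap.range (normalForm (ψ.comp (tensorInclusion A 𝒜 y₁ y₂))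
      (ψ (TensorAlgebra.ι k ⟨y₁, y₁_mem_doubleOreGrading⟩))
      (ψ (TensorAlgebra.ι k ⟨y₂, y₂_mem_doubleOreGrading⟩))) := by
  set η := ψ.comp (tensorInclusion A 𝒜 y₁ y₂) with hη
  set t₁ := TensorAlgebra.ι k (⟨y₁, y₁_mem_doubleOreGrading⟩ : doubleOreGrading A 𝒜 y₁ y₂ 1)
    with ht₁
  set t₂ := TensorAlgebra.ι k (⟨y₂, y₂_mem_doubleOreGrading⟩ : doubleOreGrading A 𝒜 y₁ y₂ 1)
    with ht₂
  have hY : ψ t₂ * ψ t₁ = p • (ψ t₁ * ψ t₂) + q • ψ t₁ ^ 2 := by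
    have e : ψ t₂ * ψ t₁ - (p • (ψ t₁ * ψ t₂) + q • ψ t₁ ^ 2) =
        ψ (t₂ * t₁ - (p • (t₁ * t₂) + q • (t₁ * t₁))) := by
      simp only [map_sub, map_add, map_smul, map_mul, pow_two]
    rw [← sub_eq_zero, e]
    refine hψ _ ⟨sub_mem (ι_mul_ι_mem _ _) (add_mem (Submodule.smul_mem _ _ (ι_mul_ι_mem _ _))
      (Submodule.smul_mem _ _ (ι_mul_ι_mem _ _))), ?_⟩
    change tensorToAlgebra _ _ = 0
    simp only [map_sub, map_add, map_smul, map_mul, ht₁, ht₂, tensorToAlgebra_ι]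
    rw [h.y₂_mul_y₁, pow_two, sub_self]
  have hstr := exists_mul_eq_of_quadraticRelations ψ hψ h hσ
  -- Normal forms are stable under left multiplication by every `ψ t`; applying this to `1` puts `ψ
  -- t` itself in normal form.
  have key : ∀ z ∈ LinearMap.range (normalForm η (ψ t₁) (ψ t₂)),
      ψ t * z ∈ LinearMap.range (normalForm η (ψ t₁) (ψ t₂)) := by
    induction t using TensorAlgebra.induction with
    | algebraMap c =>
      intro z hz
      rw [AlgHom.commutes, ← Algebra.smul_def]
      exact Submodule.smul_mem _ _ hz
    | ι b =>
      intro z hz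
      obtain ⟨a, ha, c, d, hb⟩ := mem_doubleOreGrading_one h0 b.2
      have e : TensorAlgebra.ι k b = tensorInclusion A 𝒜 y₁ y₂ (TensorAlgebra.ι k ⟨a, ha⟩) +
          c • t₁ + d • t₂ := by
        rw [tensorInclusion_ι, ht₁, ht₂, ← map_smul, ← map_smul, ← map_add, ← map_add]
        exact congrArg _ (Subtype.ext hb)
      rw [e, map_add, map_add, map_smul, map_smul, add_mul, add_mul, smul_mul_assoc,
        smul_mul_assoc]
      refine add_mem (add_mem ?_ (Submodule.smul_mem _ _ ?_)) (Submodule.smul_mem _ _ ?_)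
      · refine mul_mem_range_normalForm η hY (fun t => ⟨0, 0, TensorAlgebra.ι k ⟨a, ha⟩ * t, ?_⟩) hz
        rw [map_zero, zero_mul, zero_mul, zero_add, zero_add, map_mul]
        rfl
      · refine mul_mem_range_normalForm η hY (fun t => ?_) hz
        obtain ⟨s, s', hs⟩ := (hstr t).1
        exact ⟨s, s', 0, by rw [map_zero, add_zero]; exact hs⟩
      · refine mul_mem_range_normalForm η hY (fun t => ?_) hz
        obtain ⟨s, s', hs⟩ := (hstr t).2
        exact ⟨s, s', 0, by rw [map_zero, add_zero]; exact hs⟩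
    | mul a b ha hb =>
      intro z hz
      rw [map_mul, mul_assoc]
      exact ha _ (hb _ hz)
    | add a b ha hb =>
      intro z hz
      rw [map_add, add_mul]
      exact add_mem (ha _ hz) (hb _ hz)
  have h1 : (1 : Q) ∈ LinearMap.range (normalForm η (ψ t₁) (ψ t₂)) := by
    simpa using mem_range_normalForm η (ψ t₁) (ψ t₂) 1 0 0
  simpa using key 1 h1

end Straightening

theorem mem_span_quadraticRelations [SetLike.GradedMonoid 𝒜] (hA : IsQuadraticAlgebra 𝒜)
    (h : IsTrimmedRightDoubleOreExtension A p q y₁ y₂ σ)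
    (hσ : ∀ n, ∀ a ∈ 𝒜 n, ∀ i j, σ a i j ∈ 𝒜 n)
    {t : TensorAlgebra k (doubleOreGrading A 𝒜 y₁ y₂ 1)} :
    tensorToAlgebra (doubleOreGrading A 𝒜 y₁ y₂) t = 0 ↔
      t ∈ TwoSidedIdeal.span (quadraticRelations (doubleOreGrading A 𝒜 y₁ y₂) :
        Set (TensorAlgebra k (doubleOreGrading A 𝒜 y₁ y₂ 1))) := by
  set φ := tensorToAlgebra (doubleOreGrading A 𝒜 y₁ y₂) with hφ
  set I := TwoSidedIdeal.span (quadraticRelations (doubleOreGrading A 𝒜 y₁ y₂) :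
    Set (TensorAlgebra k (doubleOreGrading A 𝒜 y₁ y₂ 1))) with hI
  have hIφ : ∀ t ∈ I, φ t = 0 := by
    have : I ≤ TwoSidedIdeal.ker φ := TwoSidedIdeal.span_le.2 fun t ht =>
      (TwoSidedIdeal.mem_ker _).2 ht.2
    exact fun t ht => (TwoSidedIdeal.mem_ker _).1 (this ht)
  refine ⟨fun ht => ?_, hIφ t⟩
  let ψ := I.ringCon.mkₐ (α := k)
  have hψI : ∀ t, ψ t = 0 ↔ t ∈ I := fun t => by
    conv_rhs => rw [← TwoSidedIdeal.ker_ringCon_mk' I, TwoSidedIdeal.mem_ker]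
    rfl
  have hψ : ∀ t ∈ quadraticRelations (doubleOreGrading A 𝒜 y₁ y₂), ψ t = 0 := fun t ht =>
    (hψI t).2 (TwoSidedIdeal.subset_span ht)
  obtain ⟨f, hf⟩ := mem_range_normalForm_of_quadraticRelations ψ hA.degree_zero hψ h hσ t
  set t₁ := TensorAlgebra.ι k (⟨y₁, y₁_mem_doubleOreGrading⟩ : doubleOreGrading A 𝒜 y₁ y₂ 1)
    with ht₁
  set t₂ := TensorAlgebra.ι k (⟨y₂, y₂_mem_doubleOreGrading⟩ : doubleOreGrading A 𝒜 y₁ y₂ 1)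
    with ht₂
  have hlift : ψ t =
      ψ (f.sum fun ij s => tensorInclusion A 𝒜 y₁ y₂ s * (t₁ ^ ij.1 * t₂ ^ ij.2)) := by
    rw [← hf, normalForm_apply, Finsupp.sum, Finsupp.sum, map_sum]
    simp only [map_mul, map_pow, AlgHom.comp_apply]
  -- The tensor and its normal form differ by an element of `I`, so they have the same image in `B`,
  -- which is zero; freeness over `A` then kills each coefficient.
  have hzero : (f.sum fun ij s => tensorToAlgebra 𝒜 s • (y₁ ^ ij.1 * y₂ ^ ij.2)) = 0 := by
    have h1 := hIφ _ ((hψI _).1 ((map_sub ψ _ _).trans (sub_eq_zero.2 hlift)))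
    rw [map_sub, ht, zero_sub, neg_eq_zero, Finsupp.sum, map_sum] at h1
    simp only [map_mul, map_pow, hφ, tensorToAlgebra_tensorInclusion, ht₁, ht₂,
      tensorToAlgebra_ι] at h1
    exact h1
  have hcoeff : ∀ ij ∈ f.support, tensorToAlgebra 𝒜 (f ij) = 0 :=
    linearIndependent_iff'.1 h.linearIndependent f.support
      (fun ij => tensorToAlgebra 𝒜 (f ij)) hzero
  obtain ⟨R, hR, hRA⟩ := hA.relations
  -- The defining relations of `A` become quadratic relations of `B`, so whatever they generate dies
  -- in the quotient.
  have hη : ∀ s, tensorToAlgebra 𝒜 s = 0 → ψ (tensorInclusion A 𝒜 y₁ y₂ s) = 0 := by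
    have hle : TwoSidedIdeal.span (R : Set (TensorAlgebra k (𝒜 1))) ≤
        TwoSidedIdeal.ker (ψ.comp (tensorInclusion A 𝒜 y₁ y₂)) := by
      refine TwoSidedIdeal.span_le.2 fun r hr => (TwoSidedIdeal.mem_ker _).2 (hψ _ ⟨?_, ?_⟩)
      · have h2 : LinearMap.range (TensorAlgebra.ι k (M := 𝒜 1)) ^ 2 ≤
            (LinearMap.range (TensorAlgebra.ι k
              (M := doubleOreGrading A 𝒜 y₁ y₂ 1)) ^ 2).comap
                (tensorInclusion A 𝒜 y₁ y₂).toLinearMap := by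
          rw [pow_two, Submodule.mul_le]
          rintro _ ⟨a, rfl⟩ _ ⟨b, rfl⟩
          rw [Submodule.mem_comap, AlgHom.toLinearMap_apply, map_mul, tensorInclusion_ι,
            tensorInclusion_ι]
          exact ι_mul_ι_mem _ _
        exact h2 (hR hr)
      · change tensorToAlgebra _ (tensorInclusion A 𝒜 y₁ y₂ r) = 0
        rw [tensorToAlgebra_tensorInclusion, (hRA r).2 (TwoSidedIdeal.subset_span hr)]
        rfl
    exact fun s hs =>
      (TwoSidedIdeal.mem_ker (ψ.comp (tensorInclusion A 𝒜 y₁ y₂))).1 (hle ((hRA s).1 hs))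
  rw [← hψI, hlift, Finsupp.sum, map_sum]
  refine Finset.sum_eq_zero fun ij hij => ?_
  rw [map_mul, hη _ (hcoeff ij hij), zero_mul]

theorem isQuadraticAlgebra (hA : IsQuadraticAlgebra 𝒜)
    (h : IsTrimmedRightDoubleOreExtension A p q y₁ y₂ σ)
    (hσ : ∀ n, ∀ a ∈ 𝒜 n, ∀ i j, σ a i j ∈ 𝒜 n) :
    IsQuadraticAlgebra (doubleOreGrading A 𝒜 y₁ y₂) := by
  obtain ⟨_⟩ := hA.graded
  have := hA.nontrivial
  have := hA.finite_degree_one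
  exact {
    graded := h.isGradedAlgebra_doubleOreGrading hσ
    nontrivial := Subtype.val_injective.nontrivial (α := A)
    degree_zero := doubleOreGrading_zero hA.degree_zero
    finite_degree_one := finiteDimensional_doubleOreGrading_one hA.degree_zero
    generated := h.tensorToAlgebra_surjective hA.generated
    relations := ⟨quadraticRelations _, inf_le_left, fun t => mem_span_quadraticRelations hA h hσ⟩ }

end IsTrimmedRightDoubleOreExtension

end

theorem proposition2 {k B : Type*} [Field k] [Ring B] [Algebra k B]
    (A : Subalgebra k B) (𝒜 : ℕ → Submodule k A) (hA : IsKoszulAlgebra 𝒜)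
    (p q : k) (y₁ y₂ : B) (σ : A → Matrix (Fin 2) (Fin 2) A)
    (hB : IsTrimmedRightDoubleOreExtension A p q y₁ y₂ σ)
    (hσ : ∀ n, ∀ a ∈ 𝒜 n, ∀ i j, σ a i j ∈ 𝒜 n) :
    IsKoszulAlgebra (doubleOreGrading A 𝒜 y₁ y₂) := by
  obtain ⟨hquad, ⟨R⟩⟩ := hA
  obtain ⟨_⟩ := hquad.graded
  obtain ⟨_⟩ := hB.isGradedAlgebra_doubleOreGrading hσ
  exact ⟨hB.isQuadraticAlgebra hquad hσ,
    hB.nonempty_linearProjectiveResolution hquad.degree_zero R⟩
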